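/- **Conventions.** Let $\lambda$ be a regular uncountable cardinal with $\lambda=\lambda^{<\lambda}$ and $2^\lambda=\lambda^+$ (for example, $\lambda$ strongly inaccessible with $2^\lambda=\lambda^+$). Let $T$ be a complete first order theory in a language with fewer than $\lambda$ symbols. A sequence $\langle\varphi(\bar x,\bar b_i):i\in I\rangle$ of formulas with parameters in a model $N$ is *independent* if for all disjoint finite $s,t\subseteq I$ some $\bar a$ in $N$ satisfies $\varphi(\bar a,\bar b_i)$ for $i\in s$ and $\neg\varphi(\bar a,\bar b_i)$ for $i\in t$. A formula $\varphi(\bar x,\bar y)$ has the *independence property* for $T$ if for every $k<\omega$ there is an independent sequence $\langle\varphi(\bar x,\bar b_i):i<k\rangle$ in some model of $T$. $T$ has the independence property if some formula has it. A *chain* for $(T,\lambda)$ is a $\prec$-increasing continuous sequence $\langle M_\alpha:\alpha<\lambda^+\rangle$ of models of $T$ of cardinality $\lambda$ whose union is a saturated model of $T$ of cardinality $\lambda^+$. The *generic pair property* of $T$ at $\lambda$ says that along a chain (some chain, equivalently every chain) there is a club $E$ of $\lambda^+$ such that all the pairs $(M_\beta,M_\alpha)$ with $\alpha<\beta$ from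 $E$, both of cofinality $\lambda$, are isomorphic; an isomorphism of pairs $(N,M)\cong(N',M')$ is an isomorphism $N\cong N'$ that maps $M$ onto $M'$. For models $M\prec N$ of $T$ of cardinality $\lambda$, a one-to-one $f:N\to\lambda$ and $\delta<\lambda$, let $\mathrm{inv}_5^\varphi(\delta,f,M,N)$ be the set of all $\mathcal P\subseteq\mathcal P(\delta)$ for which there are tuples $\bar a_\gamma$ ($\gamma<\delta$) in $N$, with $f$ mapping the entries of $\bar a_\gamma$ below $\delta$, such that $\mathcal P=\{\{\gamma<\delta:N\models\varphi[\bar a_\gamma,\bar b]\}:\bar b\text{ a tuple in }M\}$. Let $\mathrm{inv}_6^\varphi(M,N)$ be $\langle\mathrm{inv}_5^\varphi(\delta,f,M,N):\delta<\lambda\rangle$ modulo the club filter on $\lambda$; this does not depend on $f$. **Theorem.** Suppose that $T$ has the independence property, and let $\varphi(\bar x,\bar y)$ be any formula that has it. 1. For every chain $\langle M_\alpha:\alpha<\lambda^+\rangle$ for $(T,\lambda)$ there is a club $E$ of $\lambda^+$ such that, whenever $\alpha_1<\alpha_2$ and $\beta_1<\beta_2$ are in $E$ and $\alpha_2\ne\beta_2$,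 we have $(M_{\alpha_2},M_{\alpha_1})\not\cong(M_{\beta_2},M_{\beta_1})$, and moreover $\mathrm{inv}_6^\varphi(M_{\alpha_1},M_{\alpha_2})\ne\mathrm{inv}_6^\varphi(M_{\beta_1},M_{\beta_2})$ (whichever one-to-one maps into $\lambda$ are used to compute them). In particular, for $\delta_1<\delta_2<\delta_3$ in $E$ we have $(M_{\delta_2},M_{\delta_1})\not\cong(M_{\delta_3},M_{\delta_1})$. 2. Let $M\prec N_0$ be models of $T$ of cardinality $\lambda$ such that there are tuples $\bar b_i$ in $M$ ($i<\lambda$) for which $\langle\varphi(\bar x,\bar b_i):i<\lambda\rangle$ is independent. Then $N_0$ has an elementary extension $N_1$ of cardinality $\lambda$ such that $(N_0,M)\not\cong(N_2,M)$ for every elementary extension $N_2$ of $N_1$ of cardinality $\lambda$. 3. Hence $T$ does not have the generic pair property at $\lambda$: there is no chain for $(T,\lambda)$ with a club as in its definition. -/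

import Mathlib

open Cardinal FirstOrder

universe u

namespace GenericPair

/-- The tuples `b i` (`i : ι`) of `N` make `⟨φ(x̄, b i) : i ∈ ι⟩` an independent sequence of formulas:
every finite Boolean combination is satisfied in `N`. The variables `Fin m` are `x̄`, the variables
`Fin n` are `ȳ`. -/
def IsIndependentFamily {L : FirstOrder.Language.{u, u}} {N : Type*} [L.Structure N] {m n : ℕ}
    (φ : L.Formula (Fin m ⊕ Fin n)) {ι : Type*} (b : ι → Fin n → N) : Prop :=
  ∀ s t : Finset ι, Disjoint s t →
    ∃ a : Fin m → N, (∀ i ∈ s, φ.Realize (Sum.elim a (b i))) ∧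
      ∀ i ∈ t, ¬ φ.Realize (Sum.elim a (b i))

/-- `φ(x̄, ȳ)` has the independence property for `T`: there are arbitrarily long finite independent
sequences `⟨φ(x̄, b i) : i < k⟩` in models of `T`. (For complete `T`, the choice of the model is
immaterial.) `T` has the independence property if some `φ` has it. -/
def HasIndependenceProperty {L : FirstOrder.Language.{u, u}} (T : L.Theory) {m n : ℕ}
    (φ : L.Formula (Fin m ⊕ Fin n)) : Prop :=
  ∀ k : ℕ, ∃ (N : T.ModelType.{u, u, u}) (b : Fin k → Fin n → N), IsIndependentFamily φ b

/-- `M` is saturated: every 1-type over a set of fewer than `#M` parameters (a set of formulas with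
these parameters, finitely satisfiable in `M`) is realized in `M`. -/
def IsSaturated (L : FirstOrder.Language.{u, u}) (M : Type u) [L.Structure M] : Prop :=
  ∀ A : Set M, #A < #M → ∀ p : Set (L[[A]].Formula (Fin 1)),
    (∀ q : Finset (L[[A]].Formula (Fin 1)), (q : Set (L[[A]].Formula (Fin 1))) ⊆ p →
      ∃ v : Fin 1 → M, ∀ ψ ∈ q, ψ.Realize v) →
    ∃ v : Fin 1 → M, ∀ ψ ∈ p, ψ.Realize v

/-- `M` is a saturated model of `T` of cardinality `lam⁺`, and `⟨Ms α : α < lam⁺⟩` is an increasing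
continuous sequence of elementary submodels of `M`, each of cardinality `lam`, with union `M`. -/
structure IsSaturatedChain {L : FirstOrder.Language.{u, u}} (T : L.Theory) (lam : Cardinal.{u})
    (M : Type u) [L.Structure M]
    (Ms : Set.Iio (Order.succ lam).ord → L.ElementarySubstructure M) : Prop where
  models : M ⊨ T
  card_eq : #M = Order.succ lam
  saturated : IsSaturated L M
  card_step : ∀ α, #(Ms α) = lam
  mono : Monotone Ms
  continuous : ∀ δ : Set.Iio (Order.succ lam).ord, Order.IsSuccLimit (δ : Ordinal.{u}) →
    (Ms δ : Set M) = ⋃ α : Set.Iio δ, (Ms α : Set M)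
  union_eq : ⋃ α, (Ms α : Set M) = Set.univ

/-- The pairs `(N, A)` and `(N', A')` are isomorphic. -/
def PairIso (L : FirstOrder.Language.{u, u}) {N N' : Type*} [L.Structure N] [L.Structure N']
    (A : Set N) (A' : Set N') : Prop :=
  ∃ g : N ≃[L] N', g '' A = A'

/-- The set underlying `K`, as a subset of `N` (used when `K ⊆ N`); the pair of models `(N, K)` is
then `N` together with this set. -/
def inside {L : FirstOrder.Language.{u, u}} {M : Type u} [L.Structure M] (K N : L.ElementarySubstructure M) :
    Set N :=
  {x | (x : M) ∈ K}

/-- The generic pair property of `T` at `lam`: along an increasing continuous chain of models of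
cardinality `lam` with saturated union of cardinality `lam⁺` (some chain, equivalently every one,
as any two agree on a club up to an isomorphism of the unions), for some club `E` of `lam⁺`
all the pairs `(Ms β, Ms α)` with `α < β` from `E` of cofinality `lam` are isomorphic. -/
def HasGenericPairProperty {L : FirstOrder.Language.{u, u}} (T : L.Theory) (lam : Cardinal.{u}) : Prop :=
  ∃ (M : Type u) (_ : L.Structure M)
    (Ms : Set.Iio (Order.succ lam).ord → L.ElementarySubstructure M),
    IsSaturatedChain T lam M Ms ∧
    ∃ E : Set (Set.Iio (Order.succ lam).ord), IsClub E ∧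
      ∀ α ∈ E, ∀ β ∈ E, ∀ α' ∈ E, ∀ β' ∈ E, α < β → α' < β' →
        (α : Ordinal.{u}).cof = lam → (β : Ordinal.{u}).cof = lam →
        (α' : Ordinal.{u}).cof = lam → (β' : Ordinal.{u}).cof = lam →
        PairIso L (inside (Ms α) (Ms β)) (inside (Ms α') (Ms β'))

/-- The filter on (the ordinals below) `lam` generated by the clubs. -/
def clubFilter (lam : Cardinal.{u}) : Filter (Set.Iio lam.ord) :=
  Filter.generate {C | IsClub C}

/-- For a pair `(N, A)`, a map `f : N → lam` and `δ < lam`: the set of those families `P` of subsets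
of `δ` for which there are tuples `a γ` (`γ < δ`) of elements of `N` that `f` maps below `δ`, such
that `P` consists exactly of the `U ⊆ δ` of the form `{γ < δ : N ⊨ φ(a γ, b)}` with `b` a tuple of
elements of `A`. -/
def inv5 {L : FirstOrder.Language.{u, u}} {N : Type u} [L.Structure N] {m n : ℕ}
    (φ : L.Formula (Fin m ⊕ Fin n)) {lam : Cardinal.{u}} (f : N → Set.Iio lam.ord) (A : Set N)
    (δ : Set.Iio lam.ord) : Set (Set (Set (Set.Iio lam.ord))) :=
  {P | ∃ a : Set.Iio δ → Fin m → N, (∀ γ i, f (a γ i) < δ) ∧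
    ∀ U : Set (Set.Iio lam.ord), U ∈ P ↔
      U ⊆ Set.Iio δ ∧ ∃ b : Fin n → N, (∀ j, b j ∈ A) ∧
        ∀ γ : Set.Iio δ, φ.Realize (Sum.elim (a γ) b) ↔ (γ : Set.Iio lam.ord) ∈ U}

/-- The invariant of the pair `(N, A)`: the sequence of the `inv5` modulo the club filter on `lam`,
computed through the map `f : N → lam` (for injective `f` and `#N = lam`, the result does not depend
on `f`). -/
def inv6 {L : FirstOrder.Language.{u, u}} {N : Type u} [L.Structure N] {m n : ℕ}
    (φ : L.Formula (Fin m ⊕ Fin n)) {lam : Cardinal.{u}} (f : N → Set.Iio lam.ord) (A : Set N) :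
    (clubFilter lam).Germ (Set (Set (Set (Set.Iio lam.ord)))) :=
  ((fun δ => inv5 φ f A δ : Set.Iio lam.ord → Set (Set (Set (Set.Iio lam.ord)))) :
    (clubFilter lam).Germ (Set (Set (Set (Set.Iio lam.ord)))))

end GenericPair

/-!
An isomorphism of pairs preserves `inv6`, so everything rests on changing the invariant of a pair by
extending its top model. As `inv5` at an infinite `δ` has at most `2 ^ |δ|` members (`mk_inv5_le`), it
suffices to diagonalize: given for each `δ < lam` at most `2 ^ |δ|` families `P` of subsets of `δ`, one
wants tuples `a γ` (`γ < lam`) in an extension such that, for stationarily many `δ`, the family of the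
traces `{γ < δ | φ(a γ, b)}`, with `b` from the bottom model, is none of these `P`. The type of `a γ` over
the bottom model is taken to be the average of an ultrafilter `p γ` on tuples, so the diagonalization
is a statement about ultrafilters (`exists_ultrafilters_traceFamily_notMem`).

There are altogether at most `lam` pairs `i = (δ, P)`, and each of them gets its own member of an
independent sequence, that is, a set `Y i` of an independent family. Choose points `x γ`
(`γ < lam`) of a Cantor cube with these coordinates. If the trace `U i = {γ < δ | x γ i = 1}` is not in
`P`, then `p γ` contains `Y i` exactly when `x γ i = 1`, which puts `U i` into the trace family. If `U i`
is in `P`, then `Y i` is omitted by all the `p γ`, and `U i` must not become the trace of any other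
set `Z` of the Boolean algebra. For this, the `p γ` come from a family of ultrafilters over all points of
the Cantor cube on the coordinates of the first kind (`IsFree.exists_ultrafilters`), such that
membership of any `Z` is decided on some cylinder and depends on countably many coordinates only; here
the countable chain condition of the cube enters. So it is enough that the `x γ` with `γ < δ` separate
the coordinate `i` from finite conditions, or from countable sets of coordinates, that avoid `i`
(`exists_separating`). If `2 ^ μ ≥ lam` for some `μ < lam`, a dense set of `μ` points in the cube separates
in the first sense. Otherwise `lam` is a strong limit, and the cones of a tree in which the `i` are
branches separate in the second sense at all `δ` of cofinality `ω₁` in a club.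

In an ultrapower, cut down by the Löwenheim–Skolem theorem, the averages are realized for an arbitrary
pair (`exists_elementaryEmbedding_realize_ultrafilters`), and the traces are kept by further
extensions. Along a chain, saturation of the union realizes them at a later stage, and gives an
independent sequence of length `lam`, which lies inside some step of the chain. On the
club of closure points of the function that says how late is late enough, the invariants are different
(`IsSaturatedChain.exists_isClub_forall_inv6_ne`). As every club of `lam⁺` contains three points of
cofinality `lam`, the generic pair property fails.
-/

namespace GenericPair

/-! ### Clubs in regular well-orders -/

section Clubs

open Order Set

universe v w

variable {Λ : Type v} [LinearOrder Λ] [WellFoundedLT Λ] [IsRegularCardinalOrder Λ]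

theorem mk_Iio_lt_mk (a : Λ) : #(Iio a) < #Λ := by
  have h := Ordinal.typein_lt_type (α := Λ) (· < ·) a
  rw [← ord_cardinalMk, lt_ord, Ordinal.card_typein] at h
  exact h

theorem noMaxOrder_of_aleph0_le (h : ℵ₀ ≤ #Λ) : NoMaxOrder Λ := by
  refine ⟨fun a => ?_⟩
  by_contra! H
  have : (univ : Set Λ) = insert a (Iio a) := by
    ext x
    simpa [le_iff_eq_or_lt] using H x
  have h1 : #Λ ≤ #(Iio a) + 1 := by
    rw [← mk_univ, this]
    exact mk_insert_le
  exact absurd h1 (not_le.2 (add_lt_of_lt h (mk_Iio_lt_mk a) (one_lt_aleph0.trans_le h)))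

theorem exists_forall_lt_of_mk_lt {ι : Type w} (f : ι → Λ)
    (hι : Cardinal.lift.{v} #ι < Cardinal.lift.{w} #Λ) : ∃ b, ∀ i, f i < b := by
  have h1 : ¬ IsCofinal (range f) := by
    intro hc
    have h2 := cof_le hc
    rw [cof_eq_cardinalMk] at h2
    have h3 := (Cardinal.lift_le.{w}.2 h2).trans mk_range_le_lift
    exact absurd h3 (not_le.2 hι)
  obtain ⟨b, hb⟩ := not_isCofinal_iff.1 h1
  exact ⟨b, fun i => hb _ ⟨i, rfl⟩⟩

/-- The closure points of a function form a club. -/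
theorem isClub_closurePoints (h : ℵ₀ < #Λ) (G : Λ → Λ) : IsClub {δ | ∀ γ < δ, G γ < δ} := by
  have := noMaxOrder_of_aleph0_le h.le
  refine ⟨fun t ht ht0 _ a ha γ hγ => ?_, fun a => ?_⟩
  · obtain ⟨c, hc, hγc⟩ := (lt_isLUB_iff ha).1 hγ
    exact (ht hc γ hγc).trans_le (ha.1 hc)
  · have step : ∀ c : Λ, ∃ d, c < d ∧ ∀ γ < c, G γ < d := by
      intro c
      obtain ⟨d, hd⟩ := exists_forall_lt_of_mk_lt (fun γ : Iio c => G γ)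
        (by simpa using mk_Iio_lt_mk c)
      obtain ⟨e, he⟩ := exists_gt (max c d)
      exact ⟨e, (le_max_left _ _).trans_lt he,
        fun γ hγ => (hd ⟨γ, hγ⟩).trans ((le_max_right _ _).trans_lt he)⟩
    choose s hs1 hs2 using step
    let g : ℕ → Λ := fun k => s^[k] a
    have hgs : ∀ k, g (k + 1) = s (g k) := fun k => Function.iterate_succ_apply' s k a
    have hb : ∃ b, ∀ k, g k < b := exists_forall_lt_of_mk_lt g (by simpa using h)
    obtain ⟨b, hb, hmin⟩ := WellFounded.has_min (wellFounded_lt (α := Λ)) {b | ∀ k, g k < b} hb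
    refine ⟨b, fun γ hγ => ?_, (hb 0).le⟩
    have : ∃ k, γ ≤ g k := by
      by_contra! H
      exact hmin γ H hγ
    obtain ⟨k, hk⟩ := this
    have h1 : γ < g (k + 1) := hk.trans_lt (by rw [hgs]; exact hs1 _)
    have h2 := hs2 (g (k + 1)) γ h1
    rw [← hgs] at h2
    exact h2.trans (hb _)

/-- A club contains points whose part of the club below, above a given bound, has order type
the initial ordinal of a given cardinal. -/
theorem exists_mem_club_mk_inter (h : ℵ₀ ≤ #Λ) {D : Set Λ} (hD : IsClub D) (β : Λ)
    {θ : Cardinal.{v}} (hθ : ℵ₀ ≤ θ) (hθΛ : θ < #Λ) :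
    ∃ δ ∈ D, β < δ ∧ θ ≤ #(D ∩ Ioo β δ : Set Λ) ∧ ∀ α < δ, #(D ∩ Ioo β α : Set Λ) < θ := by
  have := noMaxOrder_of_aleph0_le h
  have hcof : IsCofinal (D ∩ Ioi β) := by
    intro a
    obtain ⟨e, he⟩ := exists_gt (max a β)
    obtain ⟨d, hd, hed⟩ := hD.isCofinal e
    exact ⟨d, ⟨hd, ((le_max_right _ _).trans_lt he).trans_le hed⟩,
      ((le_max_left _ _).trans_lt he).le.trans hed⟩
  have h1 : θ ≤ #(D ∩ Ioi β : Set Λ) := by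
    have := cof_le hcof
    rw [cof_eq_cardinalMk] at this
    exact hθΛ.le.trans this
  obtain ⟨Y, hY, hYθ⟩ := le_mk_iff_exists_subset.1 h1
  obtain ⟨b, hb⟩ := exists_forall_lt_of_mk_lt (fun y : Y => (y : Λ)) (by simpa [hYθ] using hθΛ)
  have hne : {δ : Λ | θ ≤ #(D ∩ Ioo β δ : Set Λ)}.Nonempty :=
    ⟨b, by rw [mem_ofPred, ← hYθ]; exact mk_le_mk_of_subset fun y hy =>
      ⟨(hY hy).1, (hY hy).2, hb ⟨y, hy⟩⟩⟩
  obtain ⟨δ, hδ, hmin⟩ := WellFounded.has_min (wellFounded_lt (α := Λ)) _ hne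
  have hlt : ∀ α < δ, #(D ∩ Ioo β α : Set Λ) < θ := fun α hα => not_le.1 fun h' => hmin α h' hα
  have hne' : (D ∩ Ioo β δ).Nonempty := by
    rw [← mk_set_ne_zero_iff]
    intro h0
    have : θ ≤ 0 := h0 ▸ hδ
    exact absurd (hθ.trans this) (not_le.2 aleph0_pos)
  refine ⟨δ, hD.isLUB_mem inter_subset_left hne' ⟨fun x hx => hx.2.2.le, fun c hc => ?_⟩,
    ?_, hδ, hlt⟩
  · by_contra! H
    have hsub : D ∩ Ioo β δ ⊆ insert c (D ∩ Ioo β c) := fun x hx => by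
      rcases (hc hx).eq_or_lt with h' | h'
      · exact Or.inl h'
      · exact Or.inr ⟨hx.1, hx.2.1, h'⟩
    have := (hδ.trans (mk_le_mk_of_subset hsub)).trans mk_insert_le
    exact absurd this (not_le.2 (add_lt_of_lt hθ (hlt c H) (one_lt_aleph0.trans_le hθ)))
  · obtain ⟨x, hx⟩ := hne'
    exact hx.2.1.trans hx.2.2

end Clubs

/-! ### The initial segment below a regular cardinal -/

section OrdinalSegments

open Order Set

theorem mk_Iio_ord (c : Cardinal.{u}) : #(Iio c.ord) = Cardinal.lift.{u + 1} c := by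
  rw [mk_Iio_ordinal, card_ord]

theorem isRegularCardinalOrder_Iio_ord {c : Cardinal.{u}} (hc : c.IsRegular) :
    IsRegularCardinalOrder (Iio c.ord) where
  type_lt_le_ord_cof := by
    rw [Ordinal.cof_Iio, ← Ordinal.lift_cof, hc.cof_ord, Ordinal.type_lt_Iio, lift_ord]

theorem exists_isClub_subset_of_mem_clubFilter {c : Cardinal.{u}} (hc : c.IsRegular) (hc' : ℵ₀ < c)
    {s : Set (Iio c.ord)} (hs : s ∈ clubFilter c) : ∃ C ⊆ s, IsClub C := by
  obtain ⟨t, ht, htf, hts⟩ := Filter.mem_generate_iff.1 hs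
  refine ⟨_, hts, IsClub.sInter_of_countable ?_ htf.countable fun x hx => ht hx⟩
  rw [Ordinal.cof_Iio, ← Ordinal.lift_cof, hc.cof_ord]
  intro h
  rw [Cardinal.lift_eq_aleph0] at h
  exact hc'.ne' h

end OrdinalSegments

/-! ### The countable chain condition of the Cantor cube -/

section CantorCube

open Set Topology

variable {J : Type*}

/-- The basic open subset of the Cantor cube `J → ZMod 2` given by the restriction of `t` to `s`. -/
def cylinder (s : Finset J) (t : J → ZMod 2) : Set (J → ZMod 2) :=
  {x | ∀ i ∈ s, x i = t i}

theorem self_mem_cylinder (s : Finset J) (t : J → ZMod 2) : t ∈ cylinder s t := fun _ _ => rfl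

theorem isOpen_cylinder (s : Finset J) (t : J → ZMod 2) : IsOpen (cylinder s t) := by
  have : cylinder s t = ⋂ i ∈ s, (fun x : J → ZMod 2 => x i) ⁻¹' {t i} := by
    ext x
    simp [cylinder]
  rw [this]
  exact isOpen_biInter_finset fun i _ => (isOpen_discrete _).preimage (continuous_apply i)

theorem exists_cylinder_subset {U : Set (J → ZMod 2)} (hU : IsOpen U) {x : J → ZMod 2}
    (hx : x ∈ U) : ∃ s : Finset J, cylinder s x ⊆ U := by
  obtain ⟨s, u, hu, hsub⟩ := isOpen_pi_iff.1 hU x hx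
  refine ⟨s, fun y hy => hsub fun i hi => ?_⟩
  rw [hy i hi]
  exact (hu i hi).2

/-- The Cantor cube satisfies the countable chain condition, as its Haar measure is finite and
positive on nonempty open sets. -/
theorem countable_of_pairwiseDisjoint_cylinder {T : Set (Finset J × (J → ZMod 2))}
    (hT : T.PairwiseDisjoint fun st => cylinder st.1 st.2) : T.Countable := by
  let _ : MeasurableSpace (J → ZMod 2) := borel _
  have : BorelSpace (J → ZMod 2) := ⟨rfl⟩
  have h := MeasureTheory.Measure.countable_meas_pos_of_disjoint_iUnion
    (μ := (MeasureTheory.Measure.addHaar : MeasureTheory.Measure (J → ZMod 2)))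
    (As := fun st : T => cylinder st.1.1 st.1.2)
    (fun st => (isOpen_cylinder _ _).measurableSet)
    (fun a b hab => hT a.2 b.2 (fun h => hab (Subtype.ext h)))
  have huniv : {st : T | 0 < (MeasureTheory.Measure.addHaar : MeasureTheory.Measure (J → ZMod 2))
      (cylinder st.1.1 st.1.2)} = Set.univ := by
    ext st
    simpa using (isOpen_cylinder st.1.1 st.1.2).measure_pos _ ⟨_, self_mem_cylinder _ _⟩
  rw [huniv] at h
  exact countable_coe_iff.1 (countable_univ_iff.1 h)

/-- If the cylinders with a hereditary property `P` are dense, then by the countable chain condition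
countably many of them already have a dense union: a maximal disjoint family will do. -/
theorem exists_countable_dense_cylinders {P : Set (J → ZMod 2) → Prop}
    (hP : ∀ U V, U ⊆ V → P V → P U)
    (hd : ∀ U : Set (J → ZMod 2), IsOpen U → U.Nonempty → ∃ s, ∃ t ∈ U, P (cylinder s t)) :
    ∃ T : Set (Finset J × (J → ZMod 2)), T.Countable ∧ (∀ st ∈ T, P (cylinder st.1 st.2)) ∧
      Dense (⋃ st ∈ T, cylinder st.1 st.2) := by
  classical
  obtain ⟨T, hT⟩ := zorn_subset
    {T : Set (Finset J × (J → ZMod 2)) | (∀ st ∈ T, P (cylinder st.1 st.2)) ∧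
      T.PairwiseDisjoint fun st => cylinder st.1 st.2} (by
    intro c hc hchain
    refine ⟨⋃₀ c, ⟨?_, ?_⟩, fun s hs => subset_sUnion_of_mem hs⟩
    · rintro st ⟨T, hT, hst⟩
      exact (hc hT).1 st hst
    · exact (pairwiseDisjoint_sUnion hchain.directedOn).2 fun T hT => (hc hT).2)
  refine ⟨T, countable_of_pairwiseDisjoint_cylinder hT.prop.2, hT.prop.1, ?_⟩
  rw [dense_iff_inter_open]
  intro U hU hne
  by_contra! H
  obtain ⟨s, t, htU, hst⟩ := hd U hU hne
  obtain ⟨s', hs'⟩ := exists_cylinder_subset hU htU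
  have h1 : cylinder (s ∪ s') t ⊆ cylinder s t := fun x hx i hi => hx i (Finset.mem_union_left _ hi)
  have h2 : cylinder (s ∪ s') t ⊆ U :=
    fun x hx => hs' fun i hi => hx i (Finset.mem_union_right _ hi)
  have hdisj : ∀ st ∈ T, Disjoint (cylinder (s ∪ s') t) (cylinder st.1 st.2) := by
    intro st hst
    rw [Set.disjoint_left]
    intro x hx hx'
    have : x ∈ U ∩ ⋃ st ∈ T, cylinder st.1 st.2 := ⟨h2 hx, mem_biUnion hst hx'⟩
    rw [H] at this
    exact this
  have hins := hT.le_of_ge (y := insert (s ∪ s', t) T)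
    ⟨fun st hst => ?_, hT.prop.2.insert fun st hst _ => hdisj st hst⟩ (subset_insert _ _)
  · have := hdisj _ (hins (mem_insert _ _))
    exact Set.disjoint_left.1 this (self_mem_cylinder _ _) (self_mem_cylinder _ _)
  · rcases hst with rfl | hst
    · exact hP _ _ h1 hst
    · exact hT.prop.1 _ hst

/-- An ultrafilter on the Cantor cube that converges to `0` and contains all dense open sets. -/
theorem exists_ultrafilter_le_nhds_dense_mem (J : Type*) :
    ∃ q : Ultrafilter (J → ZMod 2), (q : Filter (J → ZMod 2)) ≤ 𝓝 0 ∧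
      ∀ U : Set (J → ZMod 2), IsOpen U → Dense U → U ∈ q := by
  let D : Filter (J → ZMod 2) :=
    { sets := {A | ∃ U ⊆ A, IsOpen U ∧ Dense U}
      univ_sets := ⟨univ, subset_rfl, isOpen_univ, dense_univ⟩
      sets_of_superset := fun ⟨U, hU, h⟩ hAB => ⟨U, hU.trans hAB, h⟩
      inter_sets := fun ⟨U, hU, hUo, hUd⟩ ⟨V, hV, hVo, hVd⟩ =>
        ⟨U ∩ V, inter_subset_inter hU hV, hUo.inter hVo, hUd.inter_of_isOpen_left hVd hUo⟩ }
  have hne : (𝓝 (0 : J → ZMod 2) ⊓ D).NeBot := by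
    rw [Filter.inf_neBot_iff]
    rintro A hA B ⟨U, hUB, -, hUd⟩
    obtain ⟨V, hVA, hVo, h0⟩ := mem_nhds_iff.1 hA
    exact (hUd.inter_open_nonempty V hVo ⟨0, h0⟩).mono (inter_subset_inter hVA hUB)
  refine ⟨Ultrafilter.of (𝓝 0 ⊓ D), (Ultrafilter.of_le _).trans inf_le_left, fun U hUo hUd => ?_⟩
  exact ((Ultrafilter.of_le _).trans inf_le_right) ⟨U, subset_rfl, hUo, hUd⟩

end CantorCube

/-! ### Ultrafilters over the points of the Cantor cube -/

section IndependentSets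

open Set Topology

variable {X J : Type*}

/-- The cell of the sets `Y i` given by the restriction of `t` to `s`: the points of `X` that
belong to `Y i` exactly when `t i = 1`, for `i ∈ s`. -/
def cell (Y : J → Set X) (s : Finset J) (t : J → ZMod 2) : Set X :=
  {a | ∀ i ∈ s, a ∈ Y i ↔ t i = 1}

/-- The sets `Y i` are independent modulo the filter `F`: all their cells are `F`-positive. -/
def IsFree (Y : J → Set X) (F : Filter X) : Prop :=
  ∀ s t, ∀ Z ∈ F, (Z ∩ cell Y s t).Nonempty

theorem IsFree.exists_minimal {Y : J → Set X} {F₀ : Filter X} (h : IsFree Y F₀) :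
    ∃ F ≤ F₀, Minimal (IsFree Y) F := by
  obtain ⟨F, hle, hF⟩ := zorn_le_nonempty₀ (α := (Filter X)ᵒᵈ)
    {F | IsFree Y (OrderDual.ofDual F)} (by
      intro c hc hchain y hy
      refine ⟨OrderDual.toDual (sInf (OrderDual.ofDual '' c)), ?_, fun z hz => ?_⟩
      · intro s t Z hZ
        have hdir : DirectedOn (OrderDual.ofDual ⁻¹'o (· ≥ ·)) c := by
          intro a ha b hb
          rcases hchain.total ha hb with hab | hab
          · exact ⟨b, hb, hab, le_rfl⟩
          · exact ⟨a, ha, le_rfl, hab⟩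
        rw [sInf_image] at hZ
        obtain ⟨a, ha, hZa⟩ := (Filter.mem_biInf_of_directed hdir ⟨y, hy⟩).1 hZ
        exact hc ha s t Z hZa
      · exact sInf_le (α := Filter X) ⟨z, hz, rfl⟩) (OrderDual.toDual F₀) h
  exact ⟨OrderDual.ofDual F, hle, hF.prop, fun G hG hGF => hF.le_of_ge hG hGF⟩

theorem cell_congr {Y : J → Set X} {s : Finset J} {t t' : J → ZMod 2} (h : t' ∈ cylinder s t) :
    cell Y s t' = cell Y s t := by
  ext a
  exact forall₂_congr fun i hi => by rw [h i hi]

/-- The open set of those points of the Cantor cube at which membership in `Z` is forced, modulo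
`F`, by finitely many coordinates. -/
def forced (Y : J → Set X) (F : Filter X) (Z : Set X) : Set (J → ZMod 2) :=
  {x | ∃ s, {a | a ∈ cell Y s x → a ∈ Z} ∈ F}

theorem forced_mono {Y : J → Set X} {F : Filter X} {Z Z' : Set X} (h : Z ⊆ Z') :
    forced Y F Z ⊆ forced Y F Z' :=
  fun _ ⟨s, hs⟩ => ⟨s, Filter.mem_of_superset hs fun _ ha hc => h (ha hc)⟩

theorem forced_of_mem {Y : J → Set X} {F : Filter X} {Z : Set X} (h : Z ∈ F) (x : J → ZMod 2) :
    x ∈ forced Y F Z :=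
  ⟨∅, Filter.mem_of_superset h fun _ ha _ => ha⟩

theorem forced_inter {Y : J → Set X} {F : Filter X} {Z Z' : Set X} :
    forced Y F Z ∩ forced Y F Z' ⊆ forced Y F (Z ∩ Z') := by
  classical
  rintro x ⟨⟨s, hs⟩, ⟨s', hs'⟩⟩
  refine ⟨s ∪ s', Filter.mem_of_superset (Filter.inter_mem hs hs') fun a ha hc => ⟨ha.1 ?_, ha.2 ?_⟩⟩
  · exact fun i hi => hc i (Finset.mem_union_left _ hi)
  · exact fun i hi => hc i (Finset.mem_union_right _ hi)

theorem isOpen_forced (Y : J → Set X) (F : Filter X) (Z : Set X) : IsOpen (forced Y F Z) := by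
  rw [isOpen_iff_mem_nhds]
  rintro x ⟨s, hs⟩
  refine Filter.mem_of_superset ((isOpen_cylinder s x).mem_nhds (self_mem_cylinder s x)) ?_
  intro y hy
  exact ⟨s, by rwa [cell_congr hy]⟩

theorem IsFree.forced_empty {Y : J → Set X} {F : Filter X} (h : IsFree Y F) :
    forced Y F ∅ = ∅ := by
  rw [eq_empty_iff_forall_notMem]
  rintro x ⟨s, hs⟩
  obtain ⟨a, ha, hc⟩ := h s x _ hs
  exact ha hc

theorem IsFree.not_mem_forced_compl {Y : J → Set X} {F : Filter X} (h : IsFree Y F) {Z : Set X}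
    {x : J → ZMod 2} (hx : x ∈ forced Y F Z) : x ∉ forced Y F Zᶜ := fun hx' => by
  have := forced_inter ⟨hx, hx'⟩
  rw [inter_compl_self, h.forced_empty] at this
  exact this

/-- Let `F` be minimal among the filters modulo which the `Y i` are independent (that is, as large
as possible as a family of sets). Then finitely many coordinates force, on a dense open set, any given
`Z` or its complement: if no cell compatible with that of `(s, t)` forces `Z`, then the `Y i` remain
independent when `Zᶜ` on the cell of `(s, t)` is added to `F`. -/
theorem dense_forced_union_forced_compl {Y : J → Set X} {F : Filter X} (hF : Minimal (IsFree Y) F)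
    (Z : Set X) : Dense (forced Y F Z ∪ forced Y F Zᶜ) := by
  classical
  rw [dense_iff_inter_open]
  rintro U hU ⟨t, ht⟩
  obtain ⟨s, hs⟩ := exists_cylinder_subset hU ht
  by_cases hfree : IsFree Y (F ⊓ Filter.principal {a | a ∈ cell Y s t → a ∈ Zᶜ})
  · have h1 := hF.le_of_le hfree inf_le_left
    exact ⟨t, ht, Or.inr ⟨s, h1 (Filter.mem_inf_of_right (Filter.mem_principal_self _))⟩⟩
  · simp only [IsFree, not_forall, Set.not_nonempty_iff_eq_empty] at hfree
    obtain ⟨s₁, t₁, V, hV, hVe⟩ := hfree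
    rw [Filter.mem_inf_principal] at hV
    -- modulo `F`, the cell of `(s₁, t₁)` lies inside `Z` and inside the cell of `(s, t)`;
    -- as the cells are `F`-positive, the two conditions are compatible
    have key : ∀ a, (a ∈ {a | a ∈ {a | a ∈ cell Y s t → a ∈ Zᶜ} → a ∈ V}) → a ∈ cell Y s₁ t₁ →
        a ∈ cell Y s t ∧ a ∈ Z := by
      intro a ha hc
      by_contra H
      have : a ∈ V ∩ cell Y s₁ t₁ := ⟨ha fun h h' => H ⟨h, h'⟩, hc⟩
      rw [hVe] at this
      exact this
    obtain ⟨a, ha, hac⟩ := hF.prop s₁ t₁ _ hV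
    have hcompat : ∀ i ∈ s, i ∈ s₁ → t i = t₁ i := by
      intro i hi hi'
      have h1 := (key a ha hac).1 i hi
      have h2 := hac i hi'
      have h3 : t i = 1 ↔ t₁ i = 1 := h1.symm.trans h2
      generalize t i = p at h3
      generalize t₁ i = r at h3
      revert p r
      decide
    refine ⟨fun i => if i ∈ s then t i else t₁ i, hs fun i hi => by simp [hi], Or.inl ⟨s₁, ?_⟩⟩
    refine Filter.mem_of_superset hV fun b hb hbc => (key b hb ?_).2
    rw [← cell_congr (t' := fun i => if i ∈ s then t i else t₁ i)]
    · exact hbc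
    · intro i hi
      by_cases his : i ∈ s
      · simp [his, hcompat i his hi]
      · simp [his]

/-- For sets `Y i` independent modulo a filter, there is a family of ultrafilters, one over each
point of the Cantor cube, such that membership of any fixed set is decided on some nonempty open
set and depends on countably many coordinates only.

The sets forced at a point `x` need not form an ultrafilter, as neither `Z` nor `Zᶜ` may be forced
there. So forcing is averaged near `x`, along the translate by `x` of one ultrafilter `q` that converges
to `0` and contains all dense open sets. As `q` is the same for all `x`, two points that agree on the
countable support of a dense set of deciding cylinders give the same answer. -/
theorem IsFree.exists_ultrafilters {Y : J → Set X} {F₀ : Filter X} (h : IsFree Y F₀) :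
    ∃ p : (J → ZMod 2) → Ultrafilter X, (∀ x, (p x : Filter X) ≤ F₀) ∧
      (∀ x i, Y i ∈ p x ↔ x i = 1) ∧
      (∀ Z, ∃ s t, (∀ x ∈ cylinder s t, Z ∈ p x) ∨ ∀ x ∈ cylinder s t, Z ∉ p x) ∧
      ∀ Z, ∃ w : Set J, w.Countable ∧ ∀ x x', EqOn x x' w → (Z ∈ p x ↔ Z ∈ p x') := by
  classical
  obtain ⟨F, hle, hF⟩ := h.exists_minimal
  obtain ⟨q, hq0, hqd⟩ := exists_ultrafilter_le_nhds_dense_mem J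
  let tr : (J → ZMod 2) → (J → ZMod 2) → (J → ZMod 2) := fun x y => y + x
  have htr : ∀ x, tr x = Homeomorph.addRight x := fun x => rfl
  have hdense : ∀ x U, IsOpen U → Dense U → tr x ⁻¹' U ∈ q := fun x U hUo hUd => by
    rw [htr]
    exact hqd _ (hUo.preimage (Homeomorph.addRight x).continuous)
      (hUd.preimage (Homeomorph.addRight x).isOpenMap)
  have hnhds : ∀ x U, IsOpen U → x ∈ U → tr x ⁻¹' U ∈ q := fun x U hUo hx => by
    rw [htr]
    refine hq0 ((hUo.preimage (Homeomorph.addRight x).continuous).mem_nhds ?_)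
    simpa using hx
  have hcompl : ∀ x Z, tr x ⁻¹' forced Y F Zᶜ ∈ q ↔ tr x ⁻¹' forced Y F Z ∉ q := by
    intro x Z
    constructor
    · intro h1 h2
      obtain ⟨y, hy1, hy2⟩ := q.nonempty_of_mem (Filter.inter_mem h1 h2)
      exact hF.prop.not_mem_forced_compl hy2 hy1
    · intro h1
      have h2 := hdense x _ ((isOpen_forced Y F Z).union (isOpen_forced Y F Zᶜ))
        (dense_forced_union_forced_compl hF Z)
      rw [preimage_union, Ultrafilter.union_mem_iff] at h2
      exact h2.resolve_left h1
  let p : (J → ZMod 2) → Ultrafilter X := fun x => Ultrafilter.ofComplNotMemIff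
    { sets := {Z | tr x ⁻¹' forced Y F Z ∈ q}
      univ_sets := Filter.mem_of_superset Filter.univ_mem
        fun y _ => forced_of_mem Filter.univ_mem _
      sets_of_superset := fun hZ hsub =>
        Filter.mem_of_superset hZ (preimage_mono (forced_mono hsub))
      inter_sets := fun hZ hZ' => Filter.mem_of_superset (Filter.inter_mem hZ hZ')
        fun y hy => forced_inter ⟨hy.1, hy.2⟩ }
    (fun Z => (not_congr (hcompl x Z)).trans not_not)
  have hp : ∀ x Z, Z ∈ p x ↔ tr x ⁻¹' forced Y F Z ∈ q := fun x Z => Iff.rfl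
  refine ⟨p, fun x Z hZ => ?_, fun x i => ?_, fun Z => ?_, fun Z => ?_⟩
  · exact (hp x Z).2 (Filter.mem_of_superset Filter.univ_mem fun y _ => forced_of_mem (hle hZ) _)
  · by_cases hx : x i = 1
    · refine iff_of_true ((hp _ _).2 (hnhds x _ (isOpen_forced _ _ _) ⟨{i}, ?_⟩)) hx
      exact Filter.univ_mem' fun a ha => (ha i (by simp)).2 hx
    · refine iff_of_false (fun h' => ?_) hx
      rw [hp, ← not_not (a := _ ∈ q), ← hcompl] at h'
      refine h' (hnhds x _ (isOpen_forced _ _ _) ⟨{i}, ?_⟩)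
      exact Filter.univ_mem' fun a ha ha' => hx ((ha i (by simp)).1 ha')
  · obtain ⟨t, -, ht⟩ := dense_iff_inter_open.1 (dense_forced_union_forced_compl hF Z) univ
      isOpen_univ univ_nonempty
    rcases ht with ht | ht
    · obtain ⟨s, hs⟩ := exists_cylinder_subset (isOpen_forced _ _ _) ht
      exact ⟨s, t, Or.inl fun x hx => hnhds x _ (isOpen_forced _ _ _) (hs hx)⟩
    · obtain ⟨s, hs⟩ := exists_cylinder_subset (isOpen_forced _ _ _) ht
      exact ⟨s, t, Or.inr fun x hx => (hcompl x Z).1 (hnhds x _ (isOpen_forced _ _ _) (hs hx))⟩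
  · obtain ⟨T, hTc, hTP, hTd⟩ := exists_countable_dense_cylinders
      (P := fun U => U ⊆ forced Y F Z ∨ U ⊆ forced Y F Zᶜ)
      (fun U V hUV => Or.imp hUV.trans hUV.trans) (by
        intro U hU hne
        obtain ⟨t, htU, ht⟩ := dense_iff_inter_open.1 (dense_forced_union_forced_compl hF Z) U hU hne
        rcases ht with ht | ht
        · obtain ⟨s, hs⟩ := exists_cylinder_subset (isOpen_forced _ _ _) ht
          exact ⟨s, t, htU, Or.inl hs⟩
        · obtain ⟨s, hs⟩ := exists_cylinder_subset (isOpen_forced _ _ _) ht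
          exact ⟨s, t, htU, Or.inr hs⟩)
    refine ⟨⋃ st ∈ T, (st.1 : Set J), hTc.biUnion fun st _ => st.1.countable_toSet, ?_⟩
    have main : ∀ x x', EqOn x x' (⋃ st ∈ T, (st.1 : Set J)) → Z ∈ p x → Z ∈ p x' := by
      intro x x' hxx hZ
      have hA := hdense x _ (isOpen_biUnion fun st _ => isOpen_cylinder st.1 st.2) hTd
      refine (hp _ _).2 (Filter.mem_of_superset (Filter.inter_mem hZ hA) ?_)
      rintro y ⟨hy, hyA⟩
      obtain ⟨st, hst, hyst⟩ := mem_iUnion₂.1 hyA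
      have hy' : tr x' y ∈ cylinder st.1 st.2 := by
        intro i hi
        rw [← hyst i hi]
        exact congrArg (y i + ·) (hxx (mem_biUnion hst hi)).symm
      rcases hTP st hst with h1 | h1
      · exact h1 hy'
      · exact absurd (h1 hyst) (hF.prop.not_mem_forced_compl hy)
    exact fun x x' hxx => ⟨main x x' hxx, main x' x hxx.symm⟩

end IndependentSets

/-! ### Separating the coordinates of a Cantor cube -/

section Separation

open Order Set

universe v

/-- Distinct subsets of a type `Y` index the coordinates of a Cantor cube with a dense subset of the
cardinality of `Y`: the combinatorial form of the Hewitt–Marczewski–Pondiczery theorem. -/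
theorem exists_dense_family {I Y : Type*} (c : I → Set Y) (hc : Function.Injective c) :
    ∃ X : Finset Y × Finset (Finset Y) → I → ZMod 2, ∀ (s : Finset I) (t : I → ZMod 2),
      ∃ d, ∀ i ∈ s, X d i = t i := by
  classical
  have hsep : ∀ i k : I, ∃ F : Finset Y, i ≠ k → ∃ y ∈ F, ¬ (y ∈ c i ↔ y ∈ c k) := by
    intro i k
    by_cases hik : i = k
    · exact ⟨∅, fun h => absurd hik h⟩
    · have := hc.ne hik
      rw [Ne, Set.ext_iff, not_forall] at this
      obtain ⟨y, hy⟩ := this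
      exact ⟨{y}, fun _ => ⟨y, by simp, hy⟩⟩
  choose F hF using hsep
  refine ⟨fun d i => if d.1.filter (· ∈ c i) ∈ d.2 then 1 else 0, fun s t => ?_⟩
  let E : Finset Y := s.biUnion fun i => s.biUnion (F i)
  refine ⟨⟨E, (s.filter (t · = 1)).image fun i => E.filter (· ∈ c i)⟩, fun i hi => ?_⟩
  have hiff : E.filter (· ∈ c i) ∈ (s.filter (t · = 1)).image (fun i => E.filter (· ∈ c i)) ↔
      t i = 1 := by
    simp only [Finset.mem_image, Finset.mem_filter]
    constructor
    · rintro ⟨k, ⟨hk, htk⟩, heq⟩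
      by_cases hki : k = i
      · rwa [← hki]
      · obtain ⟨y, hy, hne⟩ := hF k i hki
        have hyE : y ∈ E := Finset.mem_biUnion.2 ⟨k, hk, Finset.mem_biUnion.2 ⟨i, hi, hy⟩⟩
        have := Finset.ext_iff.1 heq y
        simp only [Finset.mem_filter, hyE, true_and] at this
        exact absurd this hne
    · exact fun h => ⟨i, ⟨hi, h⟩, rfl⟩
  dsimp only
  generalize t i = r at hiff
  split_ifs with h
  · exact (hiff.1 h).symm
  · have := mt hiff.2 h
    clear h hiff
    revert r
    decide

variable {Λ : Type v} [LinearOrder Λ] [WellFoundedLT Λ] [IsRegularCardinalOrder Λ]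

/-- The points `x γ` of the Cantor cube, for `γ < δ`, separate the coordinate `i` from the others, in
one of two ways: either both values at `i` occur among those `x γ` that satisfy any given finite
condition on other coordinates, or for any countable set `w` of other coordinates two of the `x γ`
agree on `w` but not at `i`. -/
def SeparatesBelow {I : Type*} (x : Λ → I → ZMod 2) (δ : Λ) (i : I) : Prop :=
  (∀ (s : Finset I) (t : I → ZMod 2), i ∉ s →
    ∀ e, ∃ γ < δ, (∀ k ∈ s, x γ k = t k) ∧ x γ i = e) ∨
  ∀ w : Set I, w.Countable → i ∉ w →
    ∃ γ < δ, ∃ γ' < δ, EqOn (x γ) (x γ') w ∧ x γ i ≠ x γ' i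

theorem mk_sigma_le_of_le_two_power (h : ℵ₀ ≤ #Λ) (hpow : ∀ κ < #Λ, 2 ^ κ ≤ #Λ)
    {A : Λ → Type v} (hA : ∀ δ, #(A δ) ≤ 2 ^ #(Iio δ)) : #(Σ δ, A δ) ≤ #Λ := by
  rw [mk_sigma]
  calc Cardinal.sum (fun δ => #(A δ)) ≤ Cardinal.sum (fun _ : Λ => #Λ) :=
        Cardinal.sum_le_sum _ _ fun δ => (hA δ).trans (hpow _ (mk_Iio_lt_mk δ))
    _ = #Λ := by rw [sum_const']; exact mul_eq_self h

/-- If `2 ^ μ` is at least the cardinality of `Λ` for a smaller `μ`, a dense set of cardinality `μ`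
separates all coordinates. -/
theorem exists_separating_of_le_two_power (h : ℵ₀ < #Λ) {I : Type v} (hI : #I ≤ #Λ)
    {μ : Cardinal.{v}} (hμ : μ < #Λ) (hμΛ : #Λ ≤ 2 ^ μ) :
    ∃ (x : Λ → I → ZMod 2) (S : Set Λ), IsStationary S ∧ ∀ δ ∈ S, ∀ i, SeparatesBelow x δ i := by
  classical
  have hμ0 : ℵ₀ ≤ μ := by
    by_contra! H
    exact absurd (hμΛ.trans_lt (power_lt_aleph0 (ofNat_lt_aleph0) H)) (not_lt.2 h.le)
  obtain ⟨Y, rfl⟩ : ∃ Y : Type v, #Y = μ := ⟨μ.out, mk_out μ⟩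
  obtain ⟨c⟩ : Nonempty (I ↪ Set Y) := by
    rw [← Cardinal.le_def, mk_set]
    exact hI.trans hμΛ
  obtain ⟨X, hX⟩ := exists_dense_family c c.injective
  have : Infinite Y := infinite_iff.2 hμ0
  have hD : #(Finset Y × Finset (Finset Y)) = #Y := by
    simp [mul_eq_self hμ0]
  obtain ⟨e⟩ : Nonempty ((Finset Y × Finset (Finset Y)) ↪ Λ) := by
    rw [← Cardinal.le_def, hD]
    exact hμ.le
  obtain ⟨β, hβ⟩ := exists_forall_lt_of_mk_lt e (by simpa [hD] using hμ)
  refine ⟨fun γ => X (Function.invFun e γ), Ici β, fun D hD' => ?_, fun δ hδ i => Or.inl ?_⟩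
  · obtain ⟨d, hd, hβd⟩ := hD'.isCofinal β
    exact ⟨d, hβd, hd⟩
  · intro s t his r
    obtain ⟨d, hd⟩ := hX (insert i s) (Function.update t i r)
    refine ⟨e d, (hβ d).trans_le hδ, ?_⟩
    beta_reduce
    rw [Function.leftInverse_invFun e.injective d]
    refine ⟨fun k hk => ?_, by rw [hd i (by simp), Function.update_self]⟩
    rw [hd k (by simp [hk]), Function.update_of_ne]
    rintro rfl
    exact his hk

/-- If `#Λ` is a strong limit, the coordinates `⟨δ, P⟩` are coded as branches of length `δ` of a tree
with fewer than `#Λ` nodes on each level, and the points of the cube are the characteristic functions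
of the cones above the nodes, together with `0`. If `δ` has cofinality `ω₁`, countably many branches
that all leave the branch `⟨δ, P⟩` below `δ` do so below some `α < δ`, so the cone above a node of
this branch at level `α` separates it from them. A branch of length greater than `δ` must not run through
`⟨δ, P⟩`; for this, the branches of length `δ` also code a ladder: an uncountable subset of `δ` with
countable proper initial segments. -/
theorem exists_separating_of_isStrongLimit (h : ℵ₀ < #Λ) (hlim : ∀ κ < #Λ, 2 ^ κ < #Λ)
    {Q : Λ → Type v} (hQ : ∀ δ, #(Q δ) ≤ 2 ^ #(Iio δ)) :
    ∃ (x : Λ → (Σ δ, Q δ) → ZMod 2) (S : Set Λ), IsStationary S ∧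
      ∀ δ ∈ S, ∀ P : Q δ, SeparatesBelow x δ ⟨δ, P⟩ := by
  classical
  have hc : ∀ δ, ∃ c : Q δ → Set Λ, Function.Injective c ∧ ∀ P, c P ⊆ Iio δ := by
    intro δ
    obtain ⟨c⟩ : Nonempty (Q δ ↪ Set (Iio δ)) := by
      rw [← Cardinal.le_def, mk_set]
      exact hQ δ
    refine ⟨fun P => Subtype.val '' c P,
      (image_injective.2 Subtype.val_injective).comp c.injective, fun P => ?_⟩
    rintro _ ⟨y, -, rfl⟩
    exact y.2
  choose c hcinj hcsub using hc
  let IsLadder : Λ → Set Λ → Prop := fun δ C =>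
    C ⊆ Iio δ ∧ ¬ C.Countable ∧ ∀ α < δ, (C ∩ Iio α).Countable
  have hlad : ∀ δ, ∃ C : Set Λ, C ⊆ Iio δ ∧ (∀ α < δ, (C ∩ Iio α).Countable) ∧
      ((∃ C, IsLadder δ C) → ¬ C.Countable) := by
    intro δ
    by_cases hδ : ∃ C, IsLadder δ C
    · obtain ⟨C, hC⟩ := hδ
      exact ⟨C, hC.1, hC.2.2, fun _ => hC.2.1⟩
    · exact ⟨∅, empty_subset _, by simp, fun h' => absurd h' hδ⟩
  choose C hCsub hCctb hCunc using hlad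
  -- the nodes of the tree on level `α`: traces on `α` of the ladder and of the coding set
  let N := Σ α : Λ, Set (Iio α) × Set (Iio α)
  have hlev : ∀ α : Λ, #(Set (Iio α) × Set (Iio α)) < #Λ := by
    intro α
    rw [← mul_def, mk_set]
    exact mul_lt_of_lt h.le (hlim _ (mk_Iio_lt_mk α)) (hlim _ (mk_Iio_lt_mk α))
  have hN : #(Option N) ≤ #Λ := by
    rw [mk_option, mk_sigma]
    refine (add_le_add_left ((Cardinal.sum_le_sum _ _ fun α => (hlev α).le).trans_eq ?_) 1).trans_eq
      (add_one_eq h.le)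
    rw [sum_const']
    exact mul_eq_self h.le
  obtain ⟨ν⟩ := (Cardinal.le_def _ _).1 hN
  let node : (Σ δ, Q δ) → Λ → N := fun i α =>
    ⟨α, Subtype.val ⁻¹' C i.1, Subtype.val ⁻¹' c i.1 i.2⟩
  have hnode : ∀ i k α, node i α = node k α ↔
      (∀ ζ < α, ζ ∈ C i.1 ↔ ζ ∈ C k.1) ∧ ∀ ζ < α, ζ ∈ c i.1 i.2 ↔ ζ ∈ c k.1 k.2 := by
    intro i k α
    refine (sigma_mk_injective (β := fun α : Λ => Set (Iio α) × Set (Iio α))).eq_iff.trans ?_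
    simp only [Prod.mk.injEq, Set.ext_iff, mem_preimage, Subtype.forall, mem_Iio]
  let x : Λ → (Σ δ, Q δ) → ZMod 2 := fun γ i => if ∃ α < i.1, γ = ν (some (node i α)) then 1 else 0
  have hG : ∀ α : Λ, ∃ g, ν none < g ∧ ∀ u : Set (Iio α) × Set (Iio α), ν (some ⟨α, u⟩) < g := by
    intro α
    obtain ⟨g, hg⟩ := exists_forall_lt_of_mk_lt
      (fun u : Option (Set (Iio α) × Set (Iio α)) => ν (u.map (Sigma.mk α))) (by
        simpa [mk_option] using add_lt_of_lt h.le (hlev α) (one_lt_aleph0.trans h))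
    exact ⟨g, hg none, fun u => hg (some u)⟩
  choose G hG0 hG using hG
  refine ⟨x, {δ | (∀ γ < δ, G γ < δ) ∧ ∃ C, IsLadder δ C}, fun D hD => ?_, ?_⟩
  · have : Nonempty Λ := mk_ne_zero_iff.1 (aleph0_pos.trans h).ne'
    have hcl := (isClub_closurePoints h G).inter (by rw [cof_eq_cardinalMk]; exact h.ne') hD
    have h1 : ℵ₁ < #Λ := by
      refine lt_of_le_of_lt ?_ (hlim _ h)
      rw [← succ_aleph0]
      exact succ_le_of_lt (cantor _)
    obtain ⟨δ, hδ, -, hδ1, hδ2⟩ := exists_mem_club_mk_inter h.le hcl this.some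
      (θ := ℵ₁) (aleph0_le_aleph _) h1
    refine ⟨δ, ⟨hδ.1, ({δ | ∀ γ < δ, G γ < δ} ∩ D) ∩ Ioo this.some δ, fun y hy => hy.2.2, ?_,
      fun α hα => ?_⟩, hδ.2⟩
    · rw [← le_aleph0_iff_set_countable, not_le]
      exact lt_of_lt_of_le (by rw [← succ_aleph0]; exact lt_succ _) hδ1
    · refine Countable.mono ?_ (le_aleph0_iff_set_countable.1 (lt_succ_iff.1
        (by rw [succ_aleph0]; exact hδ2 α hα)))
      exact fun y hy => ⟨hy.1.1, hy.1.2.1, hy.2⟩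
  · rintro δ ⟨hδG, hδC⟩ P
    refine Or.inr fun w hw hiw => ?_
    -- each coordinate other than `⟨δ, P⟩` branches off below `δ`
    have hsplit : ∀ k : Σ δ, Q δ, ∃ ζ, k ≠ ⟨δ, P⟩ →
        ζ < δ ∧ ∀ α, ζ < α → α < δ → ¬ (α < k.1 ∧ node ⟨δ, P⟩ α = node k α) := by
      rintro ⟨δ', P'⟩
      rcases lt_trichotomy δ' δ with hlt | heq | hgt
      · exact ⟨δ', fun _ => ⟨hlt, fun α hα _ h' => lt_asymm hα h'.1⟩⟩
      · subst heq
        by_cases hPP : P' = P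
        · exact ⟨δ', fun h' => (h' (congrArg (Sigma.mk δ') hPP)).elim⟩
        · have := (hcinj δ').ne hPP
          rw [Ne, Set.ext_iff, not_forall] at this
          obtain ⟨ζ, hζ⟩ := this
          refine ⟨ζ, fun _ => ⟨?_, fun α hα _ h' => hζ ((((hnode _ _ _).1 h'.2).2 ζ hα).symm)⟩⟩
          by_contra hζδ
          exact hζ (iff_of_false (fun h' => hζδ (hcsub _ _ h')) fun h' => hζδ (hcsub _ _ h'))
      · have : ∃ ζ < δ, ¬ (ζ ∈ C δ ↔ ζ ∈ C δ') := by
          by_contra! H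
          have hsub : C δ ⊆ C δ' ∩ Iio δ := fun ζ hζ =>
            ⟨(H ζ (hCsub δ hζ)).1 hζ, hCsub δ hζ⟩
          exact hCunc δ hδC ((hCctb δ' δ hgt).mono hsub)
        obtain ⟨ζ, hζδ, hζ⟩ := this
        exact ⟨ζ, fun _ => ⟨hζδ, fun α hα _ h' => hζ (((hnode _ _ _).1 h'.2).1 ζ hα)⟩⟩
    choose ζ hζ using hsplit
    have hne : ∀ k ∈ w, k ≠ ⟨δ, P⟩ := fun k hk h' => hiw (h' ▸ hk)
    have hsup : ∃ α < δ, ∀ k ∈ w, ζ k < α := by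
      by_contra! H
      have hsub : C δ ⊆ ⋃ k ∈ w, insert (ζ k) (C δ ∩ Iio (ζ k)) := by
        intro y hy
        obtain ⟨k, hk, hyk⟩ := H y (hCsub δ hy)
        refine mem_biUnion hk ?_
        rcases hyk.eq_or_lt with h' | h'
        · exact Or.inl h'
        · exact Or.inr ⟨hy, h'⟩
      exact hCunc δ hδC ((hw.biUnion fun k hk =>
        (hCctb δ _ (hζ k (hne k hk)).1).insert _).mono hsub)
    obtain ⟨α, hαδ, hα⟩ := hsup
    refine ⟨ν (some (node ⟨δ, P⟩ α)), (hG α _).trans (hδG α hαδ), ν none,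
      (hG0 α).trans (hδG α hαδ), fun k hk => ?_, ?_⟩
    · have h1 : ¬ ∃ β < k.1, ν (some (node ⟨δ, P⟩ α)) = ν (some (node k β)) := by
        rintro ⟨β, hβ, heq⟩
        have heq' := Option.some_injective _ (ν.injective heq)
        obtain rfl : α = β := congrArg Sigma.fst heq'
        exact (hζ k (hne k hk)).2 α (hα k hk) hαδ ⟨hβ, heq'⟩
      have h2 : ¬ ∃ β < k.1, ν none = ν (some (node k β)) := by
        rintro ⟨β, hβ, heq⟩
        exact absurd (ν.injective heq) (by simp)
      simp only [x, if_neg h1, if_neg h2]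
    · have h1 : ∃ β < δ, ν (some (node ⟨δ, P⟩ α)) = ν (some (node ⟨δ, P⟩ β)) := ⟨α, hαδ, rfl⟩
      have h2 : ¬ ∃ β < δ, ν none = ν (some (node ⟨δ, P⟩ β)) := by
        rintro ⟨β, hβ, heq⟩
        exact absurd (ν.injective heq) (by simp)
      simp only [x, if_pos h1, if_neg h2]
      exact one_ne_zero

theorem exists_separating (h : ℵ₀ < #Λ) (hpow : ∀ κ < #Λ, 2 ^ κ ≤ #Λ)
    {Q : Λ → Type v} (hQ : ∀ δ, #(Q δ) ≤ 2 ^ #(Iio δ)) :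
    ∃ (x : Λ → (Σ δ, Q δ) → ZMod 2) (S : Set Λ), IsStationary S ∧
      ∀ δ ∈ S, ∀ P : Q δ, SeparatesBelow x δ ⟨δ, P⟩ := by
  by_cases hμ : ∃ μ < #Λ, #Λ ≤ 2 ^ μ
  · obtain ⟨μ, hμ, hμΛ⟩ := hμ
    obtain ⟨x, S, hS, hx⟩ := exists_separating_of_le_two_power h
      (mk_sigma_le_of_le_two_power h.le hpow hQ) hμ hμΛ
    exact ⟨x, S, hS, fun δ hδ P => hx δ hδ _⟩
  · push Not at hμ
    exact exists_separating_of_isStrongLimit h hμ hQ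

end Separation

/-! ### Diagonalizing against families of sets -/

section Diagonalization

open Order Set

universe v

variable {Λ : Type v} [LinearOrder Λ] [WellFoundedLT Λ] [IsRegularCardinalOrder Λ]

/-- The family of those subsets of `δ` that are the traces `{γ < δ | R b γ}` of some `b`. -/
def traceFamily {B : Type*} (R : B → Λ → Prop) (δ : Λ) : Set (Set Λ) :=
  {U | U ⊆ Iio δ ∧ ∃ b, ∀ γ < δ, R b γ ↔ γ ∈ U}

/-- Given `2 ^ |δ|` families of subsets of `δ` for each `δ`, and an independent sequence of sets
`R (b i)`, there are ultrafilters `p γ` whose trace families avoid the given ones stationarily often.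
A coordinate `i = ⟨δ, P⟩` with `P` one of the given families takes care of `P`: the trace on `δ` of the
`i`-th set of the independent sequence is put into the trace family if and only if it is not in `P`. -/
theorem exists_ultrafilters_traceFamily_notMem (h : ℵ₀ < #Λ) (hpow : ∀ κ < #Λ, 2 ^ κ ≤ #Λ)
    {X : Type*} {B : Type*} (R : B → Set X) (b : Λ → B)
    (hb : ∀ s t : Finset Λ, Disjoint s t →
      ∃ a, (∀ i ∈ s, a ∈ R (b i)) ∧ ∀ i ∈ t, a ∉ R (b i))
    (Q : Λ → Set (Set (Set Λ))) (hQ : ∀ δ, #(Q δ) ≤ 2 ^ #(Iio δ)) :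
    ∃ p : Λ → Ultrafilter X,
      IsStationary {δ | traceFamily (fun b' γ => R b' ∈ p γ) δ ∉ Q δ} := by
  classical
  obtain ⟨x, S, hS, hx⟩ := exists_separating h hpow hQ
  obtain ⟨j⟩ := (Cardinal.le_def _ _).1 (mk_sigma_le_of_le_two_power h.le hpow hQ)
  let I := Σ δ, Q δ
  let Y : I → Set X := fun i => R (b (j i))
  -- `i ∈ W`: the trace prescribed by the coordinate `i` is missing from `P`, so it is to be added
  let W : Set I := {i | {γ | γ < i.1 ∧ x γ i = 1} ∉ (i.2 : Set (Set Λ))}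
  -- outside `W`, the prescribed trace is in `P`; there `Y i` is made to fail in all the ultrafilters
  let F₀ : Filter X :=
    { sets := {Z | ∃ s : Finset I, (∀ i ∈ s, i ∉ W) ∧ ∀ a, (∀ i ∈ s, a ∉ Y i) → a ∈ Z}
      univ_sets := ⟨∅, by simp⟩
      sets_of_superset := fun ⟨s, hs, hs'⟩ hsub => ⟨s, hs, fun a ha => hsub (hs' a ha)⟩
      inter_sets := by
        rintro Z Z' ⟨s, hs, hs'⟩ ⟨r, hr, hr'⟩
        refine ⟨s ∪ r, fun i hi => (Finset.mem_union.1 hi).elim (hs i) (hr i), fun a ha => ⟨?_, ?_⟩⟩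
        · exact hs' a fun i hi => ha i (Finset.mem_union_left _ hi)
        · exact hr' a fun i hi => ha i (Finset.mem_union_right _ hi) }
  have hfree : IsFree (fun i : W => Y i) F₀ := by
    rintro s t Z ⟨r, hr, hrZ⟩
    obtain ⟨a, ha1, ha2⟩ := hb
      ((s.filter (t · = 1)).image fun i : W => j i)
      ((s.filter (t · ≠ 1)).image (fun i : W => j i) ∪ r.image j) (by
        rw [Finset.disjoint_left]
        intro k hk hk'
        obtain ⟨i, hi, rfl⟩ := Finset.mem_image.1 hk
        rcases Finset.mem_union.1 hk' with hk' | hk'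
        · obtain ⟨i', hi', heq⟩ := Finset.mem_image.1 hk'
          obtain rfl := Subtype.ext (j.injective heq)
          exact (Finset.mem_filter.1 hi').2 (Finset.mem_filter.1 hi).2
        · obtain ⟨i', hi', heq⟩ := Finset.mem_image.1 hk'
          obtain rfl := j.injective heq
          exact hr _ hi' i.2)
    refine ⟨a, hrZ a fun i hi => ha2 _ (Finset.mem_union_right _ (Finset.mem_image_of_mem _ hi)),
      fun i hi => ?_⟩
    by_cases hti : t i = 1
    · exact iff_of_true
        (ha1 _ (Finset.mem_image_of_mem (fun i : W => j i) (Finset.mem_filter.2 ⟨hi, hti⟩))) hti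
    · exact iff_of_false (ha2 _ (Finset.mem_union_left _
        (Finset.mem_image_of_mem (fun i : W => j i) (Finset.mem_filter.2 ⟨hi, hti⟩)))) hti
  obtain ⟨pp, -, hpY, hpfin, hpctb⟩ := hfree.exists_ultrafilters
  refine ⟨fun γ => pp fun i => x γ i, hS.mono fun δ hδ hP => ?_⟩
  let i₀ : I := ⟨δ, ⟨_, hP⟩⟩
  have hsep := hx δ hδ ⟨_, hP⟩
  by_cases hi₀ : i₀ ∈ W
  · exact hi₀ ⟨fun γ hγ => hγ.1, b (j i₀), fun γ hγ =>
      (hpY (fun i => x γ i) ⟨i₀, hi₀⟩).trans ⟨fun h1 => ⟨hγ, h1⟩, fun h1 => h1.2⟩⟩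
  · -- a `b'` with the trace prescribed by `i₀` would have a value at each `x γ` that depends on `i₀`,
    -- whereas it is determined by the coordinates in `W`, from which `i₀` is separated
    obtain ⟨-, b', hb'⟩ := not_not.1 hi₀
    have hb'' : ∀ γ < δ, R b' ∈ pp (fun i => x γ i) ↔ x γ i₀ = 1 := fun γ hγ =>
      (hb' γ hγ).trans ⟨fun h1 => h1.2, fun h1 => ⟨hγ, h1⟩⟩
    have hi₀' : ∀ i : W, (i : I) ≠ i₀ := fun i h' => hi₀ (h' ▸ i.2)
    rcases hsep with hsep | hsep
    · obtain ⟨s, t, hst⟩ := hpfin (R b')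
      have hval : ∀ e : ZMod 2, ∃ γ < δ, (fun i : W => x γ i) ∈ cylinder s t ∧ x γ i₀ = e := by
        intro e
        obtain ⟨γ, hγ, hγs, hγe⟩ := hsep (s.image Subtype.val)
          (fun i => if hi : i ∈ W then t ⟨i, hi⟩ else 0) (by
            intro h'
            obtain ⟨i, -, hi⟩ := Finset.mem_image.1 h'
            exact hi₀' i hi) e
        refine ⟨γ, hγ, fun i hi => ?_, hγe⟩
        have := hγs i (Finset.mem_image_of_mem _ hi)
        simpa using this
      rcases hst with hst | hst
      · obtain ⟨γ, hγ, hγs, hγe⟩ := hval 0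
        have := (hb'' γ hγ).1 (hst _ hγs)
        rw [hγe] at this
        exact absurd this (by decide)
      · obtain ⟨γ, hγ, hγs, hγe⟩ := hval 1
        exact hst _ hγs ((hb'' γ hγ).2 hγe)
    · obtain ⟨w, hw, hpw⟩ := hpctb (R b')
      obtain ⟨γ, hγ, γ', hγ', heq, hne⟩ := hsep (Subtype.val '' w) (hw.image _) (by
        rintro ⟨i, -, hi⟩
        exact hi₀' i hi)
      have h1 := hpw (fun i => x γ i) (fun i => x γ' i) fun i hi => heq (mem_image_of_mem _ hi)
      rw [hb'' γ hγ, hb'' γ' hγ'] at h1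
      generalize x γ i₀ = p at h1 hne
      generalize x γ' i₀ = r at h1 hne
      revert p r
      decide

end Diagonalization

/-! ### Types in several variables over saturated structures -/

section Saturation

open FirstOrder.Language

variable {L : FirstOrder.Language.{u, u}} {M : Type u} [L.Structure M]

/-- A saturated structure realizes every type in one variable whose parameters are indexed by a type
of smaller cardinality. -/
theorem IsSaturated.exists_realize_one (hsat : IsSaturated L M) {P : Type u} (hP : #P < #M)
    (c : P → M) (p : Set (L.Formula (P ⊕ Fin 1)))
    (hp : ∀ q : Finset (L.Formula (P ⊕ Fin 1)), (q : Set (L.Formula (P ⊕ Fin 1))) ⊆ p →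
      ∃ v : Fin 1 → M, ∀ ψ ∈ q, ψ.Realize (Sum.elim c v)) :
    ∃ v : Fin 1 → M, ∀ ψ ∈ p, ψ.Realize (Sum.elim c v) := by
  classical
  let A : Set M := Set.range c
  let conv : L.Formula (P ⊕ Fin 1) → L[[A]].Formula (Fin 1) := fun ψ =>
    BoundedFormula.constantsVarsEquiv.symm
      (Formula.relabel (Sum.map (fun i => (⟨c i, i, rfl⟩ : A)) id) ψ)
  have hconv : ∀ (ψ : L.Formula (P ⊕ Fin 1)) (v : Fin 1 → M),
      (conv ψ).Realize v ↔ ψ.Realize (Sum.elim c v) := by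
    intro ψ v
    rw [Formula.Realize, ← BoundedFormula.realize_constantsVarsEquiv, Equiv.apply_symm_apply]
    refine Iff.trans Formula.realize_relabel (iff_of_eq (congrArg _ ?_))
    funext i
    rcases i with i | i <;> simp
  obtain ⟨v, hv⟩ := hsat A (mk_range_le.trans_lt hP) (conv '' p) (by
    intro q hq
    obtain ⟨q', hq', rfl⟩ := Finset.subset_set_image_iff.1 hq
    obtain ⟨v, hv⟩ := hp q' hq'
    refine ⟨v, fun ψ hψ => ?_⟩
    obtain ⟨ψ, hψ', rfl⟩ := Finset.mem_image.1 hψ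
    exact (hconv ψ v).2 (hv ψ hψ'))
  exact ⟨v, fun ψ hψ => (hconv ψ v).1 (hv _ ⟨ψ, hψ, rfl⟩)⟩

/-- An infinite saturated structure realizes every type in finitely many variables whose parameters
are indexed by a type of smaller cardinality. -/
theorem IsSaturated.exists_realize (hsat : IsSaturated L M) (hM : ℵ₀ ≤ #M) (m : ℕ) :
    ∀ {P : Type u}, #P < #M → ∀ (c : P → M) (p : Set (L.Formula (P ⊕ Fin m))),
      (∀ q : Finset (L.Formula (P ⊕ Fin m)), (q : Set (L.Formula (P ⊕ Fin m))) ⊆ p →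
        ∃ v : Fin m → M, ∀ ψ ∈ q, ψ.Realize (Sum.elim c v)) →
      ∃ v : Fin m → M, ∀ ψ ∈ p, ψ.Realize (Sum.elim c v) := by
  classical
  induction m with
  | zero =>
    intro P _ c p hp
    refine ⟨default, fun ψ hψ => ?_⟩
    obtain ⟨v, hv⟩ := hp {ψ} (by simpa using hψ)
    rw [Subsingleton.elim default v]
    exact hv ψ (by simp)
  | succ m ih =>
    intro P hP c p hp
    let e : P ⊕ Fin (m + 1) → (P ⊕ Fin 1) ⊕ Fin m :=
      Sum.elim (Sum.inl ∘ Sum.inl) (Fin.cons (Sum.inl (Sum.inr 0)) Sum.inr)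
    have he : ∀ (x : Fin 1 → M) (v : Fin m → M),
        Sum.elim (Sum.elim c x) v ∘ e = Sum.elim c (Fin.cons (x 0) v) := by
      intro x v
      funext i
      rcases i with i | i
      · rfl
      · refine Fin.cases ?_ (fun i => ?_) i <;> simp [e]
    -- the projection of the type to the first variable
    let θ : Finset (L.Formula (P ⊕ Fin (m + 1))) → L.Formula (P ⊕ Fin 1) := fun q =>
      (Formula.iInf fun ψ : q => ψ.1.relabel e).iExs (Fin m)
    have hθ : ∀ q (x : Fin 1 → M), (θ q).Realize (Sum.elim c x) ↔
        ∃ v : Fin m → M, ∀ ψ ∈ q, ψ.Realize (Sum.elim c (Fin.cons (x 0) v)) := by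
      intro q x
      simp only [θ, Formula.realize_iExs, Formula.realize_iInf, Formula.realize_relabel, he,
        Subtype.forall]
    obtain ⟨x, hx⟩ := hsat.exists_realize_one hP c (θ '' {q | (q : Set _) ⊆ p}) (by
      intro r hr
      obtain ⟨r', hr', rfl⟩ := Finset.subset_set_image_iff.1 hr
      obtain ⟨v, hv⟩ := hp (r'.biUnion id) (by
        intro ψ hψ
        obtain ⟨q, hq, hψq⟩ := Finset.mem_biUnion.1 (Finset.mem_coe.1 hψ)
        exact hr' hq hψq)
      refine ⟨fun _ => v 0, fun ψ hψ => ?_⟩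
      obtain ⟨q, hq, rfl⟩ := Finset.mem_image.1 hψ
      refine (hθ q _).2 ⟨Fin.tail v, fun ψ hψ => ?_⟩
      rw [Fin.cons_self_tail]
      exact hv ψ (Finset.mem_biUnion.2 ⟨q, hq, hψ⟩))
    have hP1 : #(P ⊕ Fin 1) < #M := by
      rw [mk_sum]
      simpa using add_lt_of_lt hM hP (one_lt_aleph0.trans_le hM)
    obtain ⟨v, hv⟩ := ih hP1 (Sum.elim c x) ((Formula.relabel e) '' p) (by
      intro r hr
      obtain ⟨q, hq, rfl⟩ := Finset.subset_set_image_iff.1 hr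
      obtain ⟨v, hv⟩ := (hθ q x).1 (hx _ ⟨q, hq, rfl⟩)
      refine ⟨v, fun ψ hψ => ?_⟩
      obtain ⟨ψ, hψ', rfl⟩ := Finset.mem_image.1 hψ
      rw [Formula.realize_relabel, he]
      exact hv ψ hψ')
    refine ⟨Fin.cons (x 0) v, fun ψ hψ => ?_⟩
    have := hv _ ⟨ψ, hψ, rfl⟩
    rwa [Formula.realize_relabel, he] at this

/-- An infinite saturated structure realizes the average type of an ultrafilter on its tuples over
a smaller set of parameters. -/
theorem IsSaturated.exists_realize_ultrafilter (hsat : IsSaturated L M) (hM : ℵ₀ ≤ #M) {m : ℕ}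
    {P : Type u} (hP : #P < #M) (c : P → M) (D : Ultrafilter (Fin m → M)) :
    ∃ a : Fin m → M, ∀ ψ : L.Formula (P ⊕ Fin m),
      ψ.Realize (Sum.elim c a) ↔ {x | ψ.Realize (Sum.elim c x)} ∈ D := by
  obtain ⟨a, ha⟩ := hsat.exists_realize hM m hP c {ψ | {x | ψ.Realize (Sum.elim c x)} ∈ D} (by
    intro q hq
    have h1 : (⋂ ψ ∈ q, {x : Fin m → M | ψ.Realize (Sum.elim c x)}) ∈ (D : Filter (Fin m → M)) :=
      (Filter.biInter_finset_mem q).2 fun ψ hψ => hq hψ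
    obtain ⟨v, hv⟩ := D.nonempty_of_mem h1
    exact ⟨v, fun ψ hψ => Set.mem_iInter₂.1 hv ψ hψ⟩)
  refine ⟨a, fun ψ => ⟨fun h => ?_, ha ψ⟩⟩
  by_contra H
  have h1 := ha ψ.not (by
    rw [← Ultrafilter.compl_mem_iff_notMem] at H
    exact H)
  exact (Formula.realize_not.1 h1) h

end Saturation

/-! ### Long independent sequences in saturated structures -/

section Independence

open FirstOrder.Language

universe w

variable {L : FirstOrder.Language.{u, u}} {m n : ℕ} (φ : L.Formula (Fin m ⊕ Fin n))

theorem IsIndependentFamily.comp {φ : L.Formula (Fin m ⊕ Fin n)} {N : Type*} [L.Structure N]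
    {ι κ : Type*} {b : ι → Fin n → N} (hb : IsIndependentFamily φ b) (e : κ → ι)
    (he : Function.Injective e) : IsIndependentFamily φ (b ∘ e) := by
  intro s t hst
  obtain ⟨a, h1, h2⟩ := hb (s.map ⟨e, he⟩) (t.map ⟨e, he⟩) ((Finset.disjoint_map _).2 hst)
  exact ⟨a, fun i hi => h1 _ (Finset.mem_map_of_mem ⟨e, he⟩ hi),
    fun i hi => h2 _ (Finset.mem_map_of_mem ⟨e, he⟩ hi)⟩

theorem IsIndependentFamily.injective {φ : L.Formula (Fin m ⊕ Fin n)} {N : Type*} [L.Structure N]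
    {ι : Type*} {b : ι → Fin n → N} (hb : IsIndependentFamily φ b) : Function.Injective b := by
  intro i k hik
  by_contra hne
  obtain ⟨a, h1, h2⟩ := hb {i} {k} (by simpa using hne)
  exact h2 k (by simp) (hik ▸ h1 i (by simp))

/-- The formula saying of a finite family of tuples that it is independent for `φ`. -/
noncomputable def independenceFormula (κ : Type w) [Finite κ] : L.Formula (κ × Fin n) :=
  open Classical in
  Formula.iInf fun s : Set κ => Formula.iExs (Fin m) (Formula.iInf fun i : κ =>
    if i ∈ s then φ.relabel (Sum.elim Sum.inr fun j => Sum.inl (i, j))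
    else (φ.relabel (Sum.elim Sum.inr fun j => Sum.inl (i, j))).not)

theorem realize_independenceFormula {κ : Type w} [Finite κ] {N : Type*} [L.Structure N]
    (v : κ × Fin n → N) :
    (independenceFormula φ κ).Realize v ↔ IsIndependentFamily φ fun i j => v (i, j) := by
  classical
  have hcomp : ∀ (a : Fin m → N) (i : κ),
      Sum.elim v a ∘ (Sum.elim Sum.inr fun j => Sum.inl (i, j)) =
        (Sum.elim a fun j => v (i, j) : Fin m ⊕ Fin n → N) := by
    intro a i
    funext k
    rcases k with k | k <;> rfl
  have key : (independenceFormula φ κ).Realize v ↔ ∀ s : Set κ, ∃ a : Fin m → N, ∀ i,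
      (i ∈ s ↔ φ.Realize (Sum.elim a fun j => v (i, j))) := by
    simp only [independenceFormula, Formula.realize_iInf, Formula.realize_iExs]
    refine forall_congr' fun s => exists_congr fun a => forall_congr' fun i => ?_
    split_ifs with his
    · simp only [Formula.realize_relabel, hcomp, his, true_iff]
    · simp only [Formula.realize_not, Formula.realize_relabel, hcomp, his, false_iff]
  rw [key]
  constructor
  · intro h s t hst
    obtain ⟨a, ha⟩ := h s
    exact ⟨a, fun i hi => (ha i).1 hi, fun i hi h' => Finset.disjoint_left.1 hst ((ha i).2 h') hi⟩
  · intro h s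
    have := Fintype.ofFinite κ
    obtain ⟨a, h1, h2⟩ := h (Finset.univ.filter (· ∈ s)) (Finset.univ.filter (· ∉ s))
      (Finset.disjoint_filter_filter_not _ _ _)
    exact ⟨a, fun i => ⟨fun hi => h1 i (by simpa using hi),
      fun hi => by_contra fun his => h2 i (by simpa using his) hi⟩⟩

theorem HasIndependenceProperty.exists_fin {φ : L.Formula (Fin m ⊕ Fin n)} {T : L.Theory}
    (hφ : HasIndependenceProperty T φ) (hT : T.IsComplete) (M : Type u) [L.Structure M]
    [Nonempty M] (hM : M ⊨ T) (k : ℕ) :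
    ∃ b : Fin k → Fin n → M, IsIndependentFamily φ b := by
  let σ : L.Sentence :=
    ((independenceFormula φ (Fin k)).relabel (Sum.inr : _ → Empty ⊕ (Fin k × Fin n))).iExs _
  have hσ : ∀ (N : Type u) [L.Structure N], N ⊨ σ ↔
      ∃ b : Fin k → Fin n → N, IsIndependentFamily φ b := by
    intro N _
    simp only [σ, Sentence.Realize, Formula.realize_iExs, Formula.realize_relabel,
      Sum.elim_comp_inr, realize_independenceFormula]
    exact ⟨fun ⟨v, hv⟩ => ⟨_, hv⟩, fun ⟨b, hb⟩ => ⟨fun ij => b ij.1 ij.2, hb⟩⟩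
  obtain ⟨N, hN⟩ := hφ k
  rcases hT.2 σ with h | h
  · exact (hσ M).1 (h.realize_sentence M)
  · exact absurd ((hσ N).2 hN) ((Sentence.realize_not N).1 (h.realize_sentence N))

variable {M : Type u} [L.Structure M]

/-- The finite set `s` of tuples can be prolonged by `k` tuples to an independent family. -/
def IsProlongable (s : Finset (Fin n → M)) (k : ℕ) : Prop :=
  ∃ c : Fin k → Fin n → M, IsIndependentFamily φ (Sum.elim (Subtype.val : s → Fin n → M) c)

theorem exists_formula_prolongable (s : Finset (Fin n → M)) (k : ℕ) {P : Type u} (c : P → M)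
    (hc : ∀ z ∈ s, ∀ j, z j ∈ Set.range c) :
    ∃ ψ : L.Formula (P ⊕ Fin n), ∀ y : Fin n → M, ψ.Realize (Sum.elim c y) ↔
      ∃ d : Fin k → Fin n → M,
        IsIndependentFamily φ (Sum.elim (Subtype.val : s → Fin n → M)
          (Sum.elim (fun _ : Unit => y) d)) := by
  choose g hg using hc
  let ρ : (s ⊕ (Unit ⊕ Fin k)) × Fin n → (P ⊕ Fin n) ⊕ (Fin k × Fin n) := fun ij =>
    Sum.elim (fun z : s => Sum.inl (Sum.inl (g z.1 z.2 ij.2)))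
      (Sum.elim (fun _ => Sum.inl (Sum.inr ij.2)) fun l => Sum.inr (l, ij.2)) ij.1
  refine ⟨((independenceFormula φ (s ⊕ (Unit ⊕ Fin k))).relabel ρ).iExs _, fun y => ?_⟩
  have hρ : ∀ v : Fin k × Fin n → M,
      (fun i j => (Sum.elim (Sum.elim c y) v ∘ ρ) (i, j)) =
        Sum.elim (Subtype.val : s → Fin n → M)
          (Sum.elim (fun _ : Unit => y) fun l j => v (l, j)) := by
    intro v
    funext i j
    rcases i with z | z | l
    · exact hg z.1 z.2 j
    · rfl
    · rfl
  simp only [Formula.realize_iExs, Formula.realize_relabel, realize_independenceFormula, hρ]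
  exact ⟨fun ⟨v, hv⟩ => ⟨_, hv⟩, fun ⟨d, hd⟩ => ⟨fun ij => d ij.1 ij.2, hd⟩⟩

/-- A saturated structure with arbitrarily long finite independent families has an independent
family of its own cardinality: a maximal set of tuples whose finite subsets can all be prolonged
arbitrarily cannot be smaller, since otherwise the type of a further member would be realized. -/
theorem IsSaturated.exists_isIndependentFamily (hsat : IsSaturated L M) (hM : ℵ₀ ≤ #M)
    (hfin : ∀ k, ∃ b : Fin k → Fin n → M, IsIndependentFamily φ b)
    {ι : Type w} (hι : Cardinal.lift.{u} #ι ≤ Cardinal.lift.{w} #M) :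
    ∃ b : ι → Fin n → M, IsIndependentFamily φ b := by
  classical
  obtain ⟨Z, hZ⟩ := zorn_subset {Z : Set (Fin n → M) |
      ∀ s : Finset (Fin n → M), (s : Set (Fin n → M)) ⊆ Z → ∀ k, IsProlongable φ s k} (by
    intro C hC hchain
    by_cases hne : C.Nonempty
    · refine ⟨⋃₀ C, fun s hs k => ?_, fun Z hZ => Set.subset_sUnion_of_mem hZ⟩
      obtain ⟨Z, hZC, hsZ⟩ := hchain.directedOn.exists_mem_subset_of_finset_subset_biUnion hne
        (f := id) (s := s) (by simpa [Set.sUnion_eq_biUnion] using hs)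
      exact hC hZC s hsZ k
    · rw [Set.not_nonempty_iff_eq_empty] at hne
      refine ⟨∅, fun s hs k => ?_, by simp [hne]⟩
      obtain ⟨b, hb⟩ := hfin k
      obtain rfl : s = ∅ := by simpa using hs
      refine ⟨b, ?_⟩
      have := hb.comp (Sum.elim (fun z : (∅ : Finset (Fin n → M)) => (Finset.notMem_empty _ z.2).elim) id)
        (by
          rintro (⟨z, hz⟩ | i) (⟨z', hz'⟩ | i') h
          · simp at hz
          · simp at hz
          · simp at hz'
          · exact congrArg Sum.inr h)
      convert this using 1
      funext i
      rcases i with ⟨z, hz⟩ | i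
      · simp at hz
      · rfl)
  have hZprop := hZ.prop
  have hcard : #M ≤ #Z := by
    by_contra! hlt
    let c : Z × Fin n → M := fun zj => zj.1.1 zj.2
    have hP : #(Z × Fin n) < #M := by
      rw [mk_prod]
      simpa using mul_lt_of_lt hM hlt (natCast_lt_aleph0.trans_le hM)
    -- the conditions on a tuple `y` which make it a further member of the family
    let E : Finset Z → ℕ → Set (Fin n → M) := fun s k => {y | ∃ d : Fin k → Fin n → M,
        IsIndependentFamily φ (Sum.elim (Subtype.val : s.image Subtype.val → Fin n → M)
          (Sum.elim (fun _ : Unit => y) d))}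
    have hEne : ∀ s k, (E s k).Nonempty := by
      intro s k
      obtain ⟨d, hd⟩ := hZprop (s.image Subtype.val) (by
        intro z hz
        obtain ⟨z', -, rfl⟩ := Finset.mem_image.1 (Finset.mem_coe.1 hz)
        exact z'.2) (k + 1)
      refine ⟨d 0, Fin.tail d, ?_⟩
      have := hd.comp (Sum.map id (Sum.elim (fun _ : Unit => (0 : Fin (k + 1))) Fin.succ)) (by
        refine Function.injective_id.sumMap ?_
        rintro (a | i) (a' | i') h
        · rfl
        · exact absurd h.symm (Fin.succ_ne_zero i')
        · exact absurd h (Fin.succ_ne_zero i)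
        · exact congrArg Sum.inr (Fin.succ_injective _ h))
      convert this using 1
      funext i
      rcases i with z | a | i <;> rfl
    have hEmono : ∀ s s' k k', s ⊆ s' → k ≤ k' → E s' k' ⊆ E s k := by
      rintro s s' k k' hs hk y ⟨d, hd⟩
      refine ⟨d ∘ Fin.castLE hk, ?_⟩
      have := hd.comp (Sum.map
        (fun z : s.image Subtype.val =>
          (⟨z.1, Finset.image_subset_image hs z.2⟩ : s'.image Subtype.val))
        (Sum.map (id : Unit → Unit) (Fin.castLE hk))) (by
        refine Function.Injective.sumMap (fun z z' h => ?_)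
          (Function.injective_id.sumMap (Fin.castLE_injective hk))
        exact Subtype.ext (congrArg (fun w => w.1) h))
      convert this using 1
      funext i
      rcases i with z | a | i <;> rfl
    have hne : (⨅ sk : Finset Z × ℕ, Filter.principal (E sk.1 sk.2)).NeBot := by
      refine Filter.iInf_neBot_of_directed' ?_ fun sk => Filter.principal_neBot_iff.2 (hEne _ _)
      intro a a'
      refine ⟨(a.1 ∪ a'.1, max a.2 a'.2), ?_, ?_⟩
      · exact Filter.principal_mono.2 (hEmono _ _ _ _ Finset.subset_union_left (le_max_left _ _))
      · exact Filter.principal_mono.2 (hEmono _ _ _ _ Finset.subset_union_right (le_max_right _ _))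
    obtain ⟨y, hy⟩ := hsat.exists_realize_ultrafilter hM hP c
      (Ultrafilter.of (⨅ sk : Finset Z × ℕ, Filter.principal (E sk.1 sk.2)))
    have hyE : ∀ s k, y ∈ E s k := by
      intro s k
      obtain ⟨ψ, hψ⟩ := exists_formula_prolongable φ (s.image Subtype.val) k c (by
        intro z hz j
        obtain ⟨z', -, rfl⟩ := Finset.mem_image.1 hz
        exact ⟨(z', j), rfl⟩)
      refine (hψ y).1 ((hy ψ).2 ?_)
      have h1 : E s k ∈ Ultrafilter.of (⨅ sk : Finset Z × ℕ, Filter.principal (E sk.1 sk.2)) :=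
        Ultrafilter.of_le _ (Filter.mem_iInf_of_mem (s, k) (Filter.mem_principal_self _))
      exact Filter.mem_of_superset h1 fun x hx => (hψ x).2 hx
    have hyZ : y ∉ Z := by
      intro hyZ
      obtain ⟨d, hd⟩ := hyE {⟨y, hyZ⟩} 0
      have := hd.injective (a₁ := Sum.inl ⟨y, by simp⟩) (a₂ := Sum.inr (Sum.inl ())) rfl
      simp at this
    refine hyZ (hZ.le_of_ge (y := insert y Z) (fun s hs k => ?_) (Set.subset_insert _ _)
      (Set.mem_insert _ _))
    have hs' : ∀ z ∈ s, z ≠ y → z ∈ Z := fun z hz hzy => (hs hz).resolve_left hzy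
    obtain ⟨d, hd⟩ := hyE (s.subtype (· ∈ Z)) k
    have hmem : ∀ z ∈ s, z ≠ y → z ∈ (s.subtype (· ∈ Z)).image Subtype.val := fun z hz hzy =>
      Finset.mem_image.2 ⟨⟨z, hs' z hz hzy⟩, by simpa using hz, rfl⟩
    refine ⟨d, ?_⟩
    let e : s ⊕ Fin k → (s.subtype (· ∈ Z)).image Subtype.val ⊕ (Unit ⊕ Fin k) :=
      Sum.elim (fun z => if hzy : z.1 = y then Sum.inr (Sum.inl ())
        else Sum.inl ⟨z.1, hmem z.1 z.2 hzy⟩) fun i => Sum.inr (Sum.inr i)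
    have hval : Sum.elim (Subtype.val : s → Fin n → M) d =
        Sum.elim (Subtype.val : (s.subtype (· ∈ Z)).image Subtype.val → Fin n → M)
          (Sum.elim (fun _ : Unit => y) d) ∘ e := by
      funext i
      rcases i with z | i
      · by_cases hzy : z.1 = y
        · simp [e, hzy]
        · simp [e, hzy]
      · rfl
    rw [hval]
    refine hd.comp e ?_
    rintro (z | i) (z' | i') h
    · refine congrArg Sum.inl (Subtype.ext ?_)
      have := congrFun hval (Sum.inl z)
      have h' := congrFun hval (Sum.inl z')
      simp only [Function.comp_apply, Sum.elim_inl] at this h'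
      rw [this, h', h]
    · by_cases hzy : z.1 = y <;> simp [e, hzy] at h
    · by_cases hzy : z'.1 = y <;> simp [e, hzy] at h
    · exact congrArg Sum.inr (by simpa [e] using h)
  have hind : IsIndependentFamily φ (Subtype.val : Z → Fin n → M) := by
    intro s t hst
    obtain ⟨d, hd⟩ := hZprop ((s ∪ t).image Subtype.val) (by
      intro z hz
      obtain ⟨z', -, rfl⟩ := Finset.mem_image.1 (Finset.mem_coe.1 hz)
      exact z'.2) 0
    have hmem : ∀ z : (s ∪ t : Finset Z), z.1.1 ∈ (s ∪ t).image Subtype.val := fun z =>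
      Finset.mem_image_of_mem _ z.2
    have h1 := hd.comp (fun z : (s ∪ t : Finset Z) => Sum.inl ⟨z.1.1, hmem z⟩) (by
      intro z z' h
      have h' := congrArg Subtype.val (Sum.inl_injective (β := Fin 0) h)
      exact Subtype.ext (Subtype.ext h'))
    obtain ⟨a, ha, ha'⟩ := h1 (Finset.univ.filter (·.1 ∈ s)) (Finset.univ.filter (·.1 ∈ t)) (by
      rw [Finset.disjoint_left]
      intro z hz hz'
      exact Finset.disjoint_left.1 hst (Finset.mem_filter.1 hz).2 (Finset.mem_filter.1 hz').2)
    exact ⟨a,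
      fun z hz => ha ⟨z, Finset.mem_union_left _ hz⟩ (by simpa using hz),
      fun z hz => ha' ⟨z, Finset.mem_union_right _ hz⟩ (by simpa using hz)⟩
  obtain ⟨e⟩ : Nonempty (ι ↪ Z) := by
    rw [← Cardinal.lift_mk_le']
    exact hι.trans (Cardinal.lift_le.2 hcard)
  exact ⟨_, hind.comp e e.injective⟩

end Independence

/-! ### Realizing averages of ultrafilters in an elementary extension -/

section ElementaryExtension

open FirstOrder.Language

universe w

variable {L : FirstOrder.Language.{u, u}} {m n : ℕ}

/-- An elementary extension of the same cardinality `lam` realizes the averages of `lam` ultrafilters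
on tuples, as far as the formula `φ` is concerned. It is found inside an ultrapower. -/
theorem exists_elementaryEmbedding_realize_ultrafilters (φ : L.Formula (Fin m ⊕ Fin n))
    {lam : Cardinal.{u}} (hlam : ℵ₀ ≤ lam) (hL : L.card ≤ lam) {N : Type u} [L.Structure N]
    (hN : #N = lam) {Λ : Type w} (hΛ : Cardinal.lift.{u} #Λ ≤ Cardinal.lift.{w} lam)
    (p : Λ → Ultrafilter (Fin m → N)) :
    ∃ (N₁ : Type u) (_ : L.Structure N₁) (j : N ↪ₑ[L] N₁) (a : Λ → Fin m → N₁), #N₁ = lam ∧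
      ∀ γ (b : Fin n → N), φ.Realize (Sum.elim (a γ) (j ∘ b)) ↔
        {x | φ.Realize (Sum.elim x b)} ∈ p γ := by
  classical
  have : Nonempty N := mk_ne_zero_iff.1 (by rw [hN]; exact (aleph0_pos.trans_le hlam).ne')
  let J := Finset (Fin n → N)
  let D : Ultrafilter J := Ultrafilter.of Filter.atTop
  have hw : ∀ γ (s : J), ∃ x : Fin m → N, ∀ b ∈ s,
      (φ.Realize (Sum.elim x b) ↔ {x | φ.Realize (Sum.elim x b)} ∈ p γ) := by
    intro γ s
    have h1 : (⋂ b ∈ s, {x : Fin m → N | φ.Realize (Sum.elim x b) ↔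
        {x | φ.Realize (Sum.elim x b)} ∈ p γ}) ∈ (p γ : Filter (Fin m → N)) := by
      refine (Filter.biInter_finset_mem s).2 fun b _ => ?_
      by_cases hb : {x : Fin m → N | φ.Realize (Sum.elim x b)} ∈ p γ
      · exact Filter.mem_of_superset hb fun x hx => iff_of_true hx hb
      · exact Filter.mem_of_superset (Ultrafilter.compl_mem_iff_notMem.2 hb)
          fun x hx => iff_of_false hx hb
    obtain ⟨x, hx⟩ := (p γ).nonempty_of_mem h1
    exact ⟨x, fun b hb => Set.mem_iInter₂.1 hx b hb⟩
  choose x hx using hw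
  let U := (D : Filter J).Product fun _ => N
  let diag : N → U := fun y => ((fun _ => y : J → N) : U)
  let a : Λ → Fin m → U := fun γ i => ((fun s => x γ s i : J → N) : U)
  have hdiag : ∀ {k : ℕ} (ψ : L.Formula (Fin k)) (v : Fin k → N),
      ψ.Realize (diag ∘ v) ↔ ψ.Realize v := by
    intro k ψ v
    refine (Ultraproduct.realize_formula_cast (u := D) (M := fun _ => N) ψ
      (fun i _ => v i)).trans ?_
    exact Filter.eventually_const
  have ha : ∀ γ (b : Fin n → N), φ.Realize (Sum.elim (a γ) (diag ∘ b)) ↔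
      {x | φ.Realize (Sum.elim x b)} ∈ p γ := by
    intro γ b
    have h1 : (Sum.elim (a γ) (diag ∘ b) : Fin m ⊕ Fin n → U) = fun k =>
        (((Sum.elim (fun i s => x γ s i) fun i _ => b i : Fin m ⊕ Fin n → J → N) k : J → N) : U) := by
      funext k
      rcases k with k | k <;> rfl
    rw [h1]
    refine (Ultraproduct.realize_formula_cast (u := D) (M := fun _ => N) φ _).trans ?_
    have h2 : ∀ s : J, (fun k => (Sum.elim (fun i s => x γ s i) fun i _ => b i :
        Fin m ⊕ Fin n → J → N) k s) = Sum.elim (x γ s) b := by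
      intro s
      funext k
      rcases k with k | k <;> rfl
    simp only [h2]
    have h3 : ∀ᶠ s in (D : Filter J), b ∈ s :=
      Ultrafilter.of_le _ (Filter.mem_of_superset (Filter.mem_atTop {b})
        fun s hs => hs (Finset.mem_singleton_self b))
    constructor
    · intro h
      obtain ⟨s, hs, hbs⟩ := (h.and h3).exists
      exact (hx γ s b hbs).1 hs
    · exact fun h => h3.mono fun s hbs => (hx γ s b hbs).2 h
  have hinj : Function.Injective diag := by
    intro y z hyz
    have := (hdiag (k := 2) ((Term.var 0).equal (Term.var 1)) ![y, z]).1 (by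
      simpa [Formula.realize_equal] using hyz)
    simpa [Formula.realize_equal] using this
  obtain ⟨S, hS, hScard⟩ := exists_elementarySubstructure_card_eq L
    (Set.range diag ∪ Set.range fun γi : Λ × Fin m => a γi.1 γi.2) lam hlam (by
      rw [Cardinal.lift_id, Cardinal.lift_id]
      refine (mk_union_le _ _).trans (add_le_of_le hlam (mk_range_le.trans_eq hN) ?_)
      rw [← Cardinal.lift_le.{w}]
      refine mk_range_le_lift.trans ?_
      rw [mk_prod, Cardinal.lift_mul]
      refine mul_le_of_le (by simpa using hlam) ?_ ?_
      · simpa using hΛ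
      · simpa using (natCast_lt_aleph0 (n := m)).le.trans hlam) (by simpa using hL) (by
      rw [Cardinal.lift_id, Cardinal.lift_id, ← hN]
      exact mk_le_of_injective hinj)
  have hSd : ∀ y, diag y ∈ S := fun y => hS (Or.inl ⟨y, rfl⟩)
  have hSa : ∀ γ i, a γ i ∈ S := fun γ i => hS (Or.inr ⟨(γ, i), rfl⟩)
  refine ⟨S, inferInstance, ⟨fun y => ⟨diag y, hSd y⟩, fun k ψ v => ?_⟩,
    fun γ i => ⟨a γ i, hSa γ i⟩, by simpa using hScard, fun γ b => ?_⟩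
  · rw [← hdiag ψ v, ← S.subtype.map_formula]
    rfl
  · rw [← ha γ b, ← S.subtype.map_formula]
    refine iff_of_eq (congrArg _ ?_)
    funext k
    rcases k with k | k <;> rfl

end ElementaryExtension

/-! ### The invariants of a pair -/

section Invariants

open FirstOrder.Language Order Set

variable {L : FirstOrder.Language.{u, u}} {m n : ℕ} (φ : L.Formula (Fin m ⊕ Fin n))
  {lam : Cardinal.{u}}

theorem aleph0_lt_mk_Iio_ord (hunc : ℵ₀ < lam) : ℵ₀ < #(Iio lam.ord) := by
  rw [mk_Iio_ord]
  simpa using hunc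

theorem two_power_le_mk_Iio_ord (hpow : lam ^< lam = lam) (hlam : 2 ≤ lam) :
    ∀ κ < #(Iio lam.ord), 2 ^ κ ≤ #(Iio lam.ord) := by
  intro κ hκ
  rw [mk_Iio_ord] at hκ ⊢
  obtain ⟨κ', rfl⟩ := Cardinal.mem_range_lift_of_le hκ.le
  have h1 : κ' < lam := Cardinal.lift_lt.1 hκ
  have h2 : (2 : Cardinal.{u}) ^ κ' ≤ lam :=
    (power_le_power_right hlam).trans ((le_powerlt lam h1).trans_eq hpow)
  simpa using Cardinal.lift_le.{u + 1}.2 h2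

theorem exists_injective_Iio_ord {N : Type u} (hN : #N = lam) :
    ∃ f : N → Iio lam.ord, Function.Injective f := by
  have : Cardinal.lift.{u + 1} #N ≤ Cardinal.lift.{u} #(Iio lam.ord) := by
    rw [mk_Iio_ord, hN, Cardinal.lift_lift]
  obtain ⟨e⟩ := Cardinal.lift_mk_le'.1 this
  exact ⟨e, e.injective⟩

theorem exists_forall_Ici_aleph0_le (hunc : ℵ₀ < lam) (hreg : lam.IsRegular) :
    ∃ β : Iio lam.ord, ∀ δ ≥ β, ℵ₀ ≤ #(Iio δ) := by
  have := isRegularCardinalOrder_Iio_ord hreg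
  have h := aleph0_lt_mk_Iio_ord hunc
  have : Infinite (Iio lam.ord) := infinite_iff.2 h.le
  obtain ⟨β, hβ⟩ := exists_forall_lt_of_mk_lt (Infinite.natEmbedding (Iio lam.ord)) (by simpa using h)
  refine ⟨β, fun δ hδ => ?_⟩
  have : Function.Injective fun k : ℕ =>
      (⟨Infinite.natEmbedding (Iio lam.ord) k, (hβ k).trans_le hδ⟩ : Iio δ) := fun k l hkl =>
    (Infinite.natEmbedding (Iio lam.ord)).injective (congrArg Subtype.val hkl)
  have := Infinite.of_injective _ this
  exact infinite_iff.1 this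

/-- Two injective maps into `lam` have the same preimages of initial segments, on a club. -/
theorem exists_isClub_forall_lt_iff (hreg : lam.IsRegular) (hunc : ℵ₀ < lam) {N : Type*}
    {f g : N → Iio lam.ord} (hf : Function.Injective f) (hg : Function.Injective g) :
    ∃ C : Set (Iio lam.ord), IsClub C ∧ ∀ δ ∈ C, ∀ x, f x < δ ↔ g x < δ := by
  classical
  have := isRegularCardinalOrder_Iio_ord hreg
  have h := aleph0_lt_mk_Iio_ord hunc
  have key : ∀ {f g : N → Iio lam.ord}, Function.Injective f →
      ∃ C : Set (Iio lam.ord), IsClub C ∧ ∀ δ ∈ C, ∀ x, f x < δ → g x < δ := by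
    intro f g hf
    refine ⟨_, isClub_closurePoints h (Function.extend f g id), fun δ hδ x hx => ?_⟩
    have := hδ _ hx
    rwa [hf.extend_apply] at this
  obtain ⟨C, hC, hC'⟩ := key (g := g) hf
  obtain ⟨D, hD, hD'⟩ := key (g := f) hg
  refine ⟨C ∩ D, hC.inter (by rw [cof_eq_cardinalMk]; exact h.ne') hD, fun δ hδ x => ?_⟩
  exact ⟨hC' δ hδ.1 x, hD' δ hδ.2 x⟩

variable {N : Type u} [L.Structure N]

theorem inv5_congr {f g : N → Iio lam.ord} {δ : Iio lam.ord} (h : ∀ x, f x < δ ↔ g x < δ)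
    (A : Set N) : inv5 φ f A δ = inv5 φ g A δ := by
  simp only [inv5, h]

theorem inv5_comp_equiv {N' : Type u} [L.Structure N'] (g : N ≃[L] N') {A : Set N} {A' : Set N'}
    (hg : g '' A = A') (f : N' → Iio lam.ord) (δ : Iio lam.ord) :
    inv5 φ (f ∘ g) A δ = inv5 φ f A' δ := by
  subst hg
  have hreal : ∀ (a : Fin m → N) (b : Fin n → N),
      φ.Realize (Sum.elim (g ∘ a) (g ∘ b)) ↔ φ.Realize (Sum.elim a b) := by
    intro a b
    rw [← Sum.comp_elim]
    exact StrongHomClass.realize_formula g φ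
  have hb : ∀ (P : (Fin n → N') → Prop), (∃ b : Fin n → N', (∀ j, b j ∈ g '' A) ∧ P b) ↔
      ∃ b : Fin n → N, (∀ j, b j ∈ A) ∧ P (g ∘ b) := by
    intro P
    constructor
    · rintro ⟨b, hb, hP⟩
      choose c hc hcb using hb
      obtain rfl : g ∘ c = b := funext hcb
      exact ⟨c, hc, hP⟩
    · rintro ⟨b, hb, hP⟩
      exact ⟨g ∘ b, fun j => mem_image_of_mem g (hb j), hP⟩
  ext P
  constructor
  · rintro ⟨a, ha, hP⟩
    refine ⟨fun γ => g ∘ a γ, ha, fun U => ?_⟩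
    rw [hP, hb]
    simp only [hreal]
  · rintro ⟨a, ha, hP⟩
    have hga : ∀ γ, g ∘ (g.symm ∘ a γ) = a γ := fun γ => funext fun i => g.apply_symm_apply _
    refine ⟨fun γ => g.symm ∘ a γ, fun γ i => ?_, fun U => ?_⟩
    · simpa using ha γ i
    · rw [hP, hb]
      refine and_congr_right fun _ => exists_congr fun b => and_congr_right fun _ =>
        forall_congr' fun γ => ?_
      rw [← hreal, hga]

theorem mk_inv5_le {f : N → Iio lam.ord} (hf : Function.Injective f) (A : Set N)
    {δ : Iio lam.ord} (hδ : ℵ₀ ≤ #(Iio δ)) : #(inv5 φ f A δ) ≤ 2 ^ #(Iio δ) := by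
  choose a ha haP using fun P : inv5 φ f A δ => P.2
  let F : inv5 φ f A δ → Iio δ → Fin m → Iio δ := fun P γ i => ⟨f (a P γ i), ha P γ i⟩
  have hF : Function.Injective F := by
    intro P P' h
    have haa : a P = a P' := by
      funext γ i
      exact hf (congrArg Subtype.val (congrFun (congrFun h γ) i))
    refine Subtype.ext (Set.ext fun U => ?_)
    rw [haP P U, haP P' U, haa]
  refine (mk_le_of_injective hF).trans ?_
  have h1 : #(Fin m → Iio δ) ≤ #(Iio δ) := by
    simpa using power_nat_le hδ (n := m)
  calc #(Iio δ → Fin m → Iio δ) = #(Fin m → Iio δ) ^ #(Iio δ) := by simp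
    _ ≤ #(Iio δ) ^ #(Iio δ) := power_le_power_right h1
    _ = 2 ^ #(Iio δ) := power_self_eq hδ

/-- The trace families of a sequence of tuples belong to the invariant on a club. -/
theorem exists_isClub_traceFamily_mem_inv5 (hreg : lam.IsRegular) (hunc : ℵ₀ < lam)
    (f : N → Iio lam.ord) (A : Set N) (a : Iio lam.ord → Fin m → N) :
    ∃ C : Set (Iio lam.ord), IsClub C ∧ ∀ δ ∈ C,
      traceFamily (fun (b : Fin n → A) γ => φ.Realize (Sum.elim (a γ) fun j => (b j : N))) δ ∈
        inv5 φ f A δ := by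
  have := isRegularCardinalOrder_Iio_ord hreg
  have h := aleph0_lt_mk_Iio_ord hunc
  have hG : ∀ γ, ∃ g, ∀ i, f (a γ i) < g := fun γ =>
    exists_forall_lt_of_mk_lt (fun i => f (a γ i)) (by
      simpa using natCast_lt_aleph0.trans h)
  choose G hG using hG
  refine ⟨_, isClub_closurePoints h G, fun δ hδ => ?_⟩
  refine ⟨fun γ => a γ, fun γ i => (hG γ i).trans (hδ γ γ.2), fun U => ?_⟩
  refine and_congr_right fun _ => ⟨?_, ?_⟩
  · rintro ⟨b, hb⟩
    exact ⟨fun j => b j, fun j => (b j).2, fun γ => hb γ γ.2⟩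
  · rintro ⟨b, hbA, hb⟩
    exact ⟨fun j => ⟨b j, hbA j⟩, fun γ hγ => hb ⟨γ, hγ⟩⟩

end Invariants

/-! ### Pairs with different invariants -/

section NonIsomorphism

open FirstOrder.Language Order Set

variable {L : FirstOrder.Language.{u, u}} {m n : ℕ} (φ : L.Formula (Fin m ⊕ Fin n))
  {lam : Cardinal.{u}}

theorem isClub_Ici {Λ : Type*} [LinearOrder Λ] (β : Λ) : IsClub (Ici β) :=
  ⟨fun _ ht ⟨_, hx⟩ _ _ ha => (ht hx).trans (ha.1 hx),
    fun a => ⟨max a β, le_max_right _ _, le_max_left _ _⟩⟩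

theorem cof_Iio_ord_ne_aleph0 (hreg : lam.IsRegular) (hunc : ℵ₀ < lam) :
    Order.cof (Iio lam.ord) ≠ ℵ₀ := by
  have := isRegularCardinalOrder_Iio_ord hreg
  rw [cof_eq_cardinalMk]
  exact (aleph0_lt_mk_Iio_ord hunc).ne'

/-- Over parameters containing an independent sequence of length `lam`, there are ultrafilters whose
trace families avoid the invariant of a given pair stationarily often. -/
theorem exists_ultrafilters_traceFamily_notMem_inv5 (hreg : lam.IsRegular) (hunc : ℵ₀ < lam)
    (hpow : lam ^< lam = lam) {X : Type u} [L.Structure X] {ι : Type*} (c : ι → X)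
    (b : Iio lam.ord → Fin n → ι) (hb : IsIndependentFamily φ fun i => c ∘ b i)
    {N : Type u} [L.Structure N] {f : N → Iio lam.ord} (hf : Function.Injective f) (A : Set N) :
    ∃ p : Iio lam.ord → Ultrafilter (Fin m → X), IsStationary {δ |
      traceFamily (fun (b : Fin n → ι) γ => {x | φ.Realize (Sum.elim x (c ∘ b))} ∈ p γ) δ ∉
        inv5 φ f A δ} := by
  classical
  have := isRegularCardinalOrder_Iio_ord hreg
  obtain ⟨β, hβ⟩ := exists_forall_Ici_aleph0_le hunc hreg
  obtain ⟨p, hp⟩ := exists_ultrafilters_traceFamily_notMem (aleph0_lt_mk_Iio_ord hunc)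
    (two_power_le_mk_Iio_ord hpow (ofNat_lt_aleph0.trans hunc).le)
    (fun b : Fin n → ι => {x : Fin m → X | φ.Realize (Sum.elim x (c ∘ b))}) b hb
    (fun δ => if ℵ₀ ≤ #(Iio δ) then inv5 φ f A δ else ∅) (by
      intro δ
      split_ifs with hδ
      · exact mk_inv5_le φ hf A hδ
      · simp)
  refine ⟨p, fun C hC => ?_⟩
  obtain ⟨δ, hδ, hδC, hδβ⟩ := hp (hC.inter (cof_Iio_ord_ne_aleph0 hreg hunc) (isClub_Ici β))
  refine ⟨δ, ?_, hδC⟩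
  rwa [mem_ofPred, if_pos (hβ δ hδβ)] at hδ

/-- If `M` contains an independent sequence of length `lam`, then `N₀` has an extension after which no
further extension of cardinality `lam` makes a pair over `M` isomorphic to `(N₀, M)`: it realizes
averages of ultrafilters whose trace families avoid the invariant of `(N₀, M)`. -/
theorem exists_extension_forall_not_pairIso (hreg : lam.IsRegular) (hunc : ℵ₀ < lam)
    (hpow : lam ^< lam = lam) (hcard : L.card < lam)
    (N₀ : Type u) [L.Structure N₀] (M : L.ElementarySubstructure N₀) (hN₀ : #N₀ = lam)
    (b : Iio lam.ord → Fin n → M) (hb : IsIndependentFamily φ b) :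
    ∃ (N₁ : Type u) (_ : L.Structure N₁) (j : N₀ ↪ₑ[L] N₁), #N₁ = lam ∧
      ∀ (N₂ : Type u) [L.Structure N₂] (k : N₁ ↪ₑ[L] N₂), #N₂ = lam →
        ¬ PairIso L (M : Set N₀) ((fun x => k (j x)) '' (M : Set N₀)) := by
  obtain ⟨f, hf⟩ := exists_injective_Iio_ord hN₀
  have hb' : IsIndependentFamily φ fun i => M.subtype ∘ b i := by
    intro s t hst
    obtain ⟨a, h1, h2⟩ := hb s t hst
    have hreal : ∀ i, φ.Realize (Sum.elim (M.subtype ∘ a) (M.subtype ∘ b i)) ↔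
        φ.Realize (Sum.elim a (b i)) := fun i => by
      rw [← Sum.comp_elim, M.subtype.map_formula]
    exact ⟨M.subtype ∘ a, fun i hi => (hreal i).2 (h1 i hi), fun i hi => mt (hreal i).1 (h2 i hi)⟩
  obtain ⟨p, hp⟩ := exists_ultrafilters_traceFamily_notMem_inv5 φ hreg hunc hpow M.subtype b hb' hf
    (M : Set N₀)
  obtain ⟨N₁, _, j, a, hN₁, ha⟩ := exists_elementaryEmbedding_realize_ultrafilters φ hunc.le
    hcard.le hN₀ (by rw [mk_Iio_ord, Cardinal.lift_lift]) p
  refine ⟨N₁, inferInstance, j, hN₁, fun N₂ _ k _ ⟨g, hg⟩ => ?_⟩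
  obtain ⟨C, hC, hCmem⟩ := exists_isClub_traceFamily_mem_inv5 φ hreg hunc (f ∘ g.symm)
    ((fun x => k (j x)) '' (M : Set N₀)) fun γ => k ∘ a γ
  obtain ⟨δ, hδ, hδC⟩ := hp hC
  refine hδ ?_
  have hmem := hCmem δ hδC
  rw [← inv5_comp_equiv φ g hg (f ∘ g.symm) δ] at hmem
  have hfg : (f ∘ g.symm) ∘ g = f := funext fun x => congrArg f (g.symm_apply_apply x)
  rw [hfg] at hmem
  convert hmem using 1
  have hreal : ∀ γ (b : Fin n → M), φ.Realize (Sum.elim (k ∘ a γ) fun i => k (j (b i))) ↔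
      {x | φ.Realize (Sum.elim x (M.subtype ∘ b))} ∈ p γ := by
    intro γ b
    rw [← ha γ, ← k.map_formula, Sum.comp_elim]
    rfl
  ext U
  refine and_congr_right fun _ => ⟨?_, ?_⟩
  · rintro ⟨b, hb⟩
    exact ⟨fun i => ⟨k (j (b i)), b i, (b i).2, rfl⟩, fun γ hγ => (hreal γ b).trans (hb γ hγ)⟩
  · rintro ⟨b, hb⟩
    choose b' hb' hbb' using fun i => (b i).2
    refine ⟨fun i => ⟨b' i, hb' i⟩, fun γ hγ => (hreal γ _).symm.trans ?_⟩
    simpa only [hbb'] using hb γ hγ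

variable {T : L.Theory} {M : Type u} [L.Structure M]
  {Ms : Iio (succ lam).ord → L.ElementarySubstructure M}

theorem IsSaturatedChain.exists_forall_mem (hMs : IsSaturatedChain T lam M Ms) (hlam : ℵ₀ ≤ lam)
    {ι : Type*} (x : ι → M) (hι : Cardinal.lift.{u + 1} #ι < Cardinal.lift #(Iio (succ lam).ord)) :
    ∃ α, ∀ i, x i ∈ Ms α := by
  have := isRegularCardinalOrder_Iio_ord (isRegular_succ hlam)
  have hx : ∀ i, ∃ α, x i ∈ Ms α := by
    intro i
    have := hMs.union_eq.ge (mem_univ (x i))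
    simpa using this
  choose α hα using hx
  obtain ⟨β, hβ⟩ := exists_forall_lt_of_mk_lt α hι
  exact ⟨β, fun i => hMs.mono (hβ i).le (hα i)⟩

theorem realize_coe {N : L.ElementarySubstructure M} {k : Type*} (ψ : L.Formula k) (v : k → N) :
    ψ.Realize (fun i => (v i : M)) ↔ ψ.Realize v :=
  N.subtype.map_formula ψ v

/-- For given `α₁`, `β₁`, `β₂`, the top model `Ms α₂` of a pair over `Ms α₁` need only be late enough in
the chain for the invariant to differ from that of the pair `(Ms β₂, Ms β₁)`: it is enough that it
contains tuples realizing over `Ms α₁` the averages of ultrafilters that diagonalize against the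
latter. -/
theorem IsSaturatedChain.exists_forall_inv6_ne (hMs : IsSaturatedChain T lam M Ms)
    (hreg : lam.IsRegular) (hunc : ℵ₀ < lam) (hpow : lam ^< lam = lam) {α₀ : Iio (succ lam).ord}
    (b : Iio lam.ord → Fin n → Ms α₀) (hb : IsIndependentFamily φ fun i j => (b i j : M))
    (α₁ β₁ β₂ : Iio (succ lam).ord) (hα₁ : α₀ ≤ α₁) :
    ∃ γ, ∀ α₂, α₁ ≤ α₂ → γ ≤ α₂ → ∀ (f : Ms α₂ → Iio lam.ord) (g : Ms β₂ → Iio lam.ord),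
      Function.Injective f → Function.Injective g →
      inv6 φ f (inside (Ms α₁) (Ms α₂)) ≠ inv6 φ g (inside (Ms β₁) (Ms β₂)) := by
  obtain ⟨g₀, hg₀⟩ := exists_injective_Iio_ord (hMs.card_step β₂)
  have hM : ℵ₀ ≤ #M := by
    rw [hMs.card_eq]
    exact hunc.le.trans (le_succ _)
  obtain ⟨p, hp⟩ := exists_ultrafilters_traceFamily_notMem_inv5 φ hreg hunc hpow
    (fun x : Ms α₁ => (x : M)) (fun i j => ⟨b i j, hMs.mono hα₁ (b i j).2⟩) hb hg₀
    (inside (Ms β₁) (Ms β₂))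
  have hreal : ∀ γ, ∃ a : Fin m → M, ∀ b : Fin n → Ms α₁,
      φ.Realize (Sum.elim a fun j => (b j : M)) ↔
        {x | φ.Realize (Sum.elim x ((fun x : Ms α₁ => (x : M)) ∘ b))} ∈ p γ := by
    intro γ
    obtain ⟨a, ha⟩ := hMs.saturated.exists_realize_ultrafilter hM (P := Ms α₁)
      (by rw [hMs.card_step, hMs.card_eq]; exact lt_succ _) (fun x => (x : M)) (p γ)
    refine ⟨a, fun b => ?_⟩
    have hrel : ∀ x : Fin m → M, Sum.elim (fun x : Ms α₁ => (x : M)) x ∘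
        (Sum.elim Sum.inr (Sum.inl ∘ b) : Fin m ⊕ Fin n → Ms α₁ ⊕ Fin m) =
          Sum.elim x fun j => (b j : M) := by
      intro x
      funext k
      rcases k with k | k <;> rfl
    have := ha (φ.relabel (Sum.elim Sum.inr (Sum.inl ∘ b)))
    simp only [Formula.realize_relabel, hrel] at this
    exact this
  choose a ha using hreal
  obtain ⟨γ, hγ⟩ := hMs.exists_forall_mem hunc.le (fun γi : Iio lam.ord × Fin m => a γi.1 γi.2) (by
    rw [mk_prod, mk_Iio_ord, mk_Iio_ord]
    have h1 : Cardinal.lift.{u + 1} lam * (m : Cardinal) < Cardinal.lift.{u + 1} (succ lam) :=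
      mul_lt_of_lt (aleph0_le_lift.2 (hunc.le.trans (le_succ lam)))
        (Cardinal.lift_lt.2 (lt_succ lam))
        (natCast_lt_aleph0.trans_le (aleph0_le_lift.2 (hunc.le.trans (le_succ lam))))
    simpa using h1)
  refine ⟨γ, fun α₂ hα hα₂ f g hf hg heq => ?_⟩
  let a₂ : Iio lam.ord → Fin m → Ms α₂ := fun ξ i => ⟨a ξ i, hMs.mono hα₂ (hγ (ξ, i))⟩
  have hcof := cof_Iio_ord_ne_aleph0 hreg hunc
  obtain ⟨C₁, hC₁eq, hC₁⟩ := exists_isClub_subset_of_mem_clubFilter hreg hunc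
    (Filter.Germ.coe_eq.1 heq)
  obtain ⟨C₂, hC₂, hC₂iff⟩ := exists_isClub_forall_lt_iff hreg hunc hg₀ hg
  obtain ⟨C₃, hC₃, hC₃mem⟩ := exists_isClub_traceFamily_mem_inv5 φ hreg hunc f
    (inside (Ms α₁) (Ms α₂)) a₂
  obtain ⟨δ, hδ, ⟨hδ₁, hδ₂⟩, hδ₃⟩ := hp ((hC₁.inter hcof hC₂).inter hcof hC₃)
  refine hδ ?_
  have hmem := hC₃mem δ hδ₃
  have h1 : inv5 φ f (inside (Ms α₁) (Ms α₂)) δ = inv5 φ g (inside (Ms β₁) (Ms β₂)) δ := hC₁eq hδ₁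
  rw [h1, ← inv5_congr φ (hC₂iff δ hδ₂)] at hmem
  convert hmem using 1
  have hreal₂ : ∀ ξ (b : Fin n → inside (Ms α₁) (Ms α₂)),
      φ.Realize (Sum.elim (a₂ ξ) fun j => (b j : Ms α₂)) ↔
        {x | φ.Realize (Sum.elim x ((fun x : Ms α₁ => (x : M)) ∘ fun j =>
          (⟨(b j : Ms α₂), (b j).2⟩ : Ms α₁)))} ∈ p ξ := by
    intro ξ b
    rw [← ha ξ, ← realize_coe φ]
    refine iff_of_eq (congrArg _ ?_)
    funext k
    rcases k with k | k <;> rfl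
  ext U
  refine and_congr_right fun hU => ⟨?_, ?_⟩
  · rintro ⟨b, hb⟩
    exact ⟨fun j => ⟨⟨b j, hMs.mono hα (b j).2⟩, (b j).2⟩,
      fun ξ hξ => (hreal₂ ξ _).trans (hb ξ hξ)⟩
  · rintro ⟨b, hb⟩
    exact ⟨_, fun ξ hξ => (hreal₂ ξ b).symm.trans (hb ξ hξ)⟩

/-- An isomorphism of pairs preserves the invariant. -/
theorem exists_inv6_eq_of_pairIso {N N' : Type u} [L.Structure N] [L.Structure N'] {A : Set N}
    {A' : Set N'} (h : PairIso L A A') (hN' : #N' = lam) :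
    ∃ (f : N → Iio lam.ord) (g : N' → Iio lam.ord), Function.Injective f ∧ Function.Injective g ∧
      inv6 φ f A = inv6 φ g A' := by
  obtain ⟨e, he⟩ := h
  obtain ⟨g, hg⟩ := exists_injective_Iio_ord hN'
  have h : (fun δ => inv5 φ (g ∘ e) A δ) = fun δ => inv5 φ g A' δ :=
    funext fun δ => inv5_comp_equiv φ e he g δ
  refine ⟨g ∘ e, g, hg.comp e.injective, hg, ?_⟩
  simp only [inv6, h]

/-- Along a chain, pairs with indices in a suitable club and with different top models have different
invariants. The club consists of closure points, so that the later one of the two top models is late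
enough with respect to all the other indices. -/
theorem IsSaturatedChain.exists_isClub_forall_inv6_ne (hMs : IsSaturatedChain T lam M Ms)
    (hT : T.IsComplete) (hreg : lam.IsRegular) (hunc : ℵ₀ < lam) (hpow : lam ^< lam = lam)
    (hφ : HasIndependenceProperty T φ) :
    ∃ E : Set (Iio (succ lam).ord), IsClub E ∧
      ∀ α₁ ∈ E, ∀ α₂ ∈ E, ∀ β₁ ∈ E, ∀ β₂ ∈ E, α₁ < α₂ → β₁ < β₂ → α₂ ≠ β₂ →
        ∀ (f : Ms α₂ → Iio lam.ord) (g : Ms β₂ → Iio lam.ord),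
          Function.Injective f → Function.Injective g →
          inv6 φ f (inside (Ms α₁) (Ms α₂)) ≠ inv6 φ g (inside (Ms β₁) (Ms β₂)) := by
  classical
  have hregs := isRegular_succ hunc.le
  have huncs : ℵ₀ < succ lam := hunc.trans (lt_succ lam)
  have := isRegularCardinalOrder_Iio_ord hregs
  have hΛ := aleph0_lt_mk_Iio_ord huncs
  have hM : ℵ₀ ≤ #M := by
    rw [hMs.card_eq]
    exact huncs.le
  have : Nonempty M := mk_ne_zero_iff.1 (aleph0_pos.trans_le hM).ne'
  have hsmall : ∀ k : ℕ, Cardinal.lift.{u + 1} #(Iio lam.ord × Fin k) <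
      Cardinal.lift.{u + 1} #(Iio (succ lam).ord) := by
    intro k
    rw [mk_prod, mk_Iio_ord, mk_Iio_ord]
    have h1 : Cardinal.lift.{u + 1} lam * (k : Cardinal) < Cardinal.lift.{u + 1} (succ lam) :=
      mul_lt_of_lt (aleph0_le_lift.2 huncs.le) (Cardinal.lift_lt.2 (lt_succ lam))
        (natCast_lt_aleph0.trans_le (aleph0_le_lift.2 huncs.le))
    simpa using h1
  obtain ⟨b, hb⟩ := hMs.saturated.exists_isIndependentFamily φ hM
    (hφ.exists_fin hT M hMs.models) (ι := Iio lam.ord) (by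
      rw [mk_Iio_ord, hMs.card_eq, Cardinal.lift_lift]
      exact Cardinal.lift_le.2 (le_succ lam))
  obtain ⟨α₀, hα₀⟩ := hMs.exists_forall_mem hunc.le
    (fun ij : Iio lam.ord × Fin n => b ij.1 ij.2) (hsmall n)
  have hγ : ∀ α₁ β₁ β₂ : Iio (succ lam).ord, ∃ γ, α₀ ≤ α₁ → ∀ α₂, α₁ ≤ α₂ → γ ≤ α₂ →
      ∀ (f : Ms α₂ → Iio lam.ord) (g : Ms β₂ → Iio lam.ord),
        Function.Injective f → Function.Injective g →
        inv6 φ f (inside (Ms α₁) (Ms α₂)) ≠ inv6 φ g (inside (Ms β₁) (Ms β₂)) := by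
    intro α₁ β₁ β₂
    by_cases hα₁ : α₀ ≤ α₁
    · obtain ⟨γ, hγ⟩ := hMs.exists_forall_inv6_ne φ hreg hunc hpow
        (fun i j => ⟨b i j, hα₀ (i, j)⟩) hb α₁ β₁ β₂ hα₁
      exact ⟨γ, fun _ => hγ⟩
    · exact ⟨α₀, fun h => absurd h hα₁⟩
  choose γ hγ using hγ
  have hG : ∀ ξ : Iio (succ lam).ord, ∃ G, ∀ α₁ ≤ ξ, ∀ β₁ ≤ ξ, ∀ β₂ ≤ ξ, γ α₁ β₁ β₂ < G := by
    intro ξ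
    have hIic : #(Iic ξ) < #(Iio (succ lam).ord) := by
      rw [← Iio_insert]
      exact mk_insert_le.trans_lt
        (add_lt_of_lt hΛ.le (mk_Iio_lt_mk ξ) (one_lt_aleph0.trans hΛ))
    obtain ⟨G, hG⟩ := exists_forall_lt_of_mk_lt
      (fun x : Iic ξ × Iic ξ × Iic ξ => γ x.1 x.2.1 x.2.2) (by
        rw [mk_prod, mk_prod]
        simpa using mul_lt_of_lt hΛ.le hIic (mul_lt_of_lt hΛ.le hIic hIic))
    exact ⟨G, fun α₁ h1 β₁ h2 β₂ h3 => hG (⟨α₁, h1⟩, ⟨β₁, h2⟩, ⟨β₂, h3⟩)⟩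
  choose G hG using hG
  refine ⟨{δ | ∀ ξ < δ, G ξ < δ} ∩ Ici α₀, (isClub_closurePoints hΛ G).inter
    (cof_Iio_ord_ne_aleph0 hregs huncs) (isClub_Ici α₀), ?_⟩
  have key : ∀ {α₁ α₂ β₁ β₂ : Iio (succ lam).ord}, α₀ ≤ α₁ → (∀ ξ < α₂, G ξ < α₂) →
      α₁ < α₂ → β₁ < β₂ → β₂ < α₂ → ∀ (f : Ms α₂ → Iio lam.ord) (g : Ms β₂ → Iio lam.ord),
        Function.Injective f → Function.Injective g →
        inv6 φ f (inside (Ms α₁) (Ms α₂)) ≠ inv6 φ g (inside (Ms β₁) (Ms β₂)) := by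
    intro α₁ α₂ β₁ β₂ h0 hα₂ h1 h2 h3
    have h4 := hα₂ (max α₁ β₂) (max_lt h1 h3)
    have h5 := hG (max α₁ β₂) α₁ (le_max_left _ _) β₁ (h2.le.trans (le_max_right _ _)) β₂
      (le_max_right _ _)
    exact hγ α₁ β₁ β₂ h0 α₂ h1.le (h5.trans h4).le
  intro α₁ hα₁ α₂ hα₂ β₁ hβ₁ β₂ hβ₂ hα hβ hne f g hf hg
  rcases hne.lt_or_gt with hlt | hgt
  · exact (key hβ₁.2 hβ₂.1 hβ hα hlt g f hg hf).symm
  · exact key hα₁.2 hα₂.1 hα hβ hgt f g hf hg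

/-- A club of `lam⁺` contains points of cofinality `lam` above any given bound. -/
theorem exists_mem_club_cof_eq (hreg : lam.IsRegular) {D : Set (Iio (succ lam).ord)}
    (hD : IsClub D) (β : Iio (succ lam).ord) :
    ∃ δ ∈ D, β < δ ∧ (δ : Ordinal.{u}).cof = lam := by
  have hregs := isRegular_succ hreg.aleph0_le
  have := isRegularCardinalOrder_Iio_ord hregs
  have hθ : ℵ₀ ≤ Cardinal.lift.{u + 1} lam := aleph0_le_lift.2 hreg.aleph0_le
  obtain ⟨δ, hδD, hβδ, hδ, hlt⟩ := exists_mem_club_mk_inter (θ := Cardinal.lift.{u + 1} lam)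
    (by rw [mk_Iio_ord]; exact aleph0_le_lift.2 hregs.aleph0_le) hD β hθ (by
      rw [mk_Iio_ord, Cardinal.lift_lt]
      exact lt_succ lam)
  refine ⟨δ, hδD, hβδ, le_antisymm ?_ ?_⟩
  · exact (Ordinal.cof_le_card _).trans (lt_succ_iff.1 (lt_ord.1 δ.2))
  · rw [← Cardinal.lift_le.{u + 1}, Ordinal.lift_cof, ← Ordinal.cof_Iio, le_cof_iff]
    intro s hs
    by_contra! hs'
    have hmem : ∀ z : s, z.1.1 < (succ lam).ord := fun z => z.1.2.trans δ.2
    have hsub : D ∩ Ioo β δ ⊆ ⋃ z : s, insert (⟨z.1.1, hmem z⟩ : Iio (succ lam).ord)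
        (D ∩ Ioo β ⟨z.1.1, hmem z⟩) := by
      intro x hx
      obtain ⟨z, hz, hxz⟩ := hs ⟨x.1, hx.2.2⟩
      refine mem_iUnion.2 ⟨⟨z, hz⟩, ?_⟩
      rcases eq_or_lt_of_le (show x.1 ≤ z.1 from hxz) with h | h
      · exact Or.inl (Subtype.ext h)
      · exact Or.inr ⟨hx.1, hx.2.1, h⟩
    have h1 : #(⋃ z : s, insert (⟨z.1.1, hmem z⟩ : Iio (succ lam).ord)
        (D ∩ Ioo β ⟨z.1.1, hmem z⟩) : Set _) < Cardinal.lift.{u + 1} lam := by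
      refine (card_iUnion_lt_iff_forall_of_isRegular hreg.lift hs').2 fun z => ?_
      exact mk_insert_le.trans_lt
        (add_lt_of_lt hθ (hlt _ z.1.2) (one_lt_aleph0.trans_le hθ))
    exact absurd (hδ.trans (mk_le_mk_of_subset hsub)) (not_le.2 h1)

end NonIsomorphism

end GenericPair

theorem theorem2p7 {L : FirstOrder.Language.{u, u}} (T : L.Theory) (hT : T.IsComplete)
    (lam : Cardinal.{u}) (hreg : lam.IsRegular) (hunc : ℵ₀ < lam) (hpow : lam ^< lam = lam)
    (hcard : L.card < lam) (hsucc : Order.succ lam = 2 ^ lam)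
    {m n : ℕ} (φ : L.Formula (Fin m ⊕ Fin n)) (hφ : GenericPair.HasIndependenceProperty T φ) :
    -- non-isomorphic pairs along every chain
    (∀ (M : Type u) [L.Structure M]
      (Ms : Set.Iio (Order.succ lam).ord → L.ElementarySubstructure M),
      GenericPair.IsSaturatedChain T lam M Ms →
      ∃ E : Set (Set.Iio (Order.succ lam).ord), IsClub E ∧
        ∀ α₁ ∈ E, ∀ α₂ ∈ E, ∀ β₁ ∈ E, ∀ β₂ ∈ E, α₁ < α₂ → β₁ < β₂ → α₂ ≠ β₂ →
          ¬ GenericPair.PairIso L (GenericPair.inside (Ms α₁) (Ms α₂))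
              (GenericPair.inside (Ms β₁) (Ms β₂)) ∧
          ∀ (f : Ms α₂ → Set.Iio lam.ord) (g : Ms β₂ → Set.Iio lam.ord),
            Function.Injective f → Function.Injective g →
            GenericPair.inv6 φ f (GenericPair.inside (Ms α₁) (Ms α₂)) ≠
              GenericPair.inv6 φ g (GenericPair.inside (Ms β₁) (Ms β₂))) ∧
    -- extensions destroying the isomorphism type of a given pair `(N₀, M)`
    (∀ (N₀ : Type u) [L.Structure N₀] (M : L.ElementarySubstructure N₀),
      N₀ ⊨ T → #N₀ = lam → #M = lam →
      (∃ b : Set.Iio lam.ord → Fin n → M, GenericPair.IsIndependentFamily φ b) →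
      ∃ (N₁ : Type u) (_ : L.Structure N₁) (j : N₀ ↪ₑ[L] N₁), #N₁ = lam ∧
        ∀ (N₂ : Type u) [L.Structure N₂] (k : N₁ ↪ₑ[L] N₂), #N₂ = lam →
          ¬ GenericPair.PairIso L (M : Set N₀) ((fun x => k (j x)) '' (M : Set N₀))) ∧
    -- the generic pair property fails
    ¬ GenericPair.HasGenericPairProperty T lam := by
  refine ⟨fun M _ Ms hMs => ?_, fun N₀ _ M _ hN₀ _ ⟨b, hb⟩ =>
    GenericPair.exists_extension_forall_not_pairIso φ hreg hunc hpow hcard N₀ M hN₀ b hb, ?_⟩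
  · obtain ⟨E, hE, h⟩ := hMs.exists_isClub_forall_inv6_ne φ hT hreg hunc hpow hφ
    refine ⟨E, hE, fun α₁ hα₁ α₂ hα₂ β₁ hβ₁ β₂ hβ₂ hα hβ hne => ⟨fun hiso => ?_,
      h α₁ hα₁ α₂ hα₂ β₁ hβ₁ β₂ hβ₂ hα hβ hne⟩⟩
    obtain ⟨f, g, hf, hg, hfg⟩ :=
      GenericPair.exists_inv6_eq_of_pairIso φ hiso (hMs.card_step β₂)
    exact h α₁ hα₁ α₂ hα₂ β₁ hβ₁ β₂ hβ₂ hα hβ hne f g hf hg hfg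
  · rintro ⟨M, _, Ms, hMs, E', hE', h'⟩
    obtain ⟨E, hE, h⟩ := hMs.exists_isClub_forall_inv6_ne φ hT hreg hunc hpow hφ
    have hD := hE.inter (GenericPair.cof_Iio_ord_ne_aleph0 (isRegular_succ hunc.le)
      (hunc.trans (Order.lt_succ lam))) hE'
    have hpos : (0 : Ordinal.{u}) < (Order.succ lam).ord :=
      Cardinal.ord_pos.2 (zero_le.trans_lt (Order.lt_succ lam))
    obtain ⟨α₁, hα₁, -, hc₁⟩ := GenericPair.exists_mem_club_cof_eq hreg hD ⟨0, hpos⟩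
    obtain ⟨α₂, hα₂, h₁₂, hc₂⟩ := GenericPair.exists_mem_club_cof_eq hreg hD α₁
    obtain ⟨α₃, hα₃, h₂₃, hc₃⟩ := GenericPair.exists_mem_club_cof_eq hreg hD α₂
    have hiso := h' α₁ hα₁.2 α₂ hα₂.2 α₁ hα₁.2 α₃ hα₃.2 h₁₂ (h₁₂.trans h₂₃) hc₁ hc₂ hc₁ hc₃
    obtain ⟨f, g, hf, hg, hfg⟩ :=
      GenericPair.exists_inv6_eq_of_pairIso φ hiso (hMs.card_step α₃)
    exact h α₁ hα₁.1 α₂ hα₂.1 α₁ hα₁.1 α₃ hα₃.1 h₁₂ (h₁₂.trans h₂₃) h₂₃.ne f g hf hg hfg
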